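/- Write $z=x+iy$ with $y>0$, $e(x)=e^{2\pi i x}$, and $\lambda(s)=s(1-s)$. Let $W_{0,\nu}(y)=\sqrt{y/\pi}\,K_\nu(y/2)$ be the Whittaker function, $K_\nu$ being the modified Bessel function. For $f$ with $f(z+1)=f(z)$ write $\int_0^1 f(x+iy)e(-nx)\,dx$ for its $n$-th Fourier coefficient at height $y$. Let $u_j$ be a Maass cusp form of weight $0$ for $\mathrm{SL}_2(\mathbb Z)$ with eigenvalue $\tfrac14+t_j^2$, $t_j\in\mathbb R$; that is, $u_j$ is a smooth $\mathrm{SL}_2(\mathbb Z)$-invariant function on the upper half-plane, square-integrable on $\mathrm{SL}_2(\mathbb Z)\backslash\mathbb H$ with respect to $dx\,dy/y^2$, with $y^2(\partial_x^2+\partial_y^2)u_j=-(\tfrac14+t_j^2)u_j$ and with vanishing $0$-th Fourier coefficient. Suppose that $u_j$ is even or odd, i.e. $u_j(-\bar z)=u_j(z)$ for all $z$ or $u_j(-\bar z)=-u_j(z)$ for all $z$. For an even integer $k>0$ let $$u_{j,k}=\prod_{0\le l<k/2}\bigl(\tfrac14+t_j^2-\lambda(-l)\bigr)^{-1/2}\;K_{k-2}\cdots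 K_2K_0\,u_j,\qquad K_m=\frac m2+y\Bigl(i\frac{\partial}{\partial x}+\frac{\partial}{\partial y}\Bigr),$$ be the raised Maass cusp form of weight $k$, with Fourier expansion $u_{j,k}(z)=\sum_{n\in\mathbb Z}a_n(y)e(nx)$. Then for every integer $A\ge0$ and every $\varepsilon>0$ there is a constant $C>0$ depending only on $A$ and $\varepsilon$ such that, for all such $k$ and $u_j$, the following holds. There are complex numbers $c_j(n)$, $n\neq0$, such that the $n$-th Fourier coefficient of $u_j$ at height $y$ is $\frac{c_j(n)}{\sqrt{|n|}}W_{0,it_j}(4\pi|n|y)$ for all $n\ne0$ and $y>0$. Moreover $a_0(y)=0$ for all $y>0$, and for all integers $n\neq0$ and all $y>0$ $$|a_n(y)+a_{-n}(y)|\le C\,2^k k^A\sqrt y\,|c_j(|n|)|\left(\frac{1+|t_j|}{|n|y}\right)^A\left(1+\frac{1+|t_j|}{|n|y}\right)^{\varepsilon}.$$ -/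

import Mathlib

open UpperHalfPlane
open scoped ContDiff

noncomputable section

namespace MaassRaised

/-- A function on the upper half-plane is smooth (as a function of `x` and `y`). -/
def IsSmooth (f : ℍ → ℂ) : Prop :=
  ContDiffOn ℝ ∞ (f ∘ ofComplex) {z : ℂ | 0 < z.im}

/-- The partial derivative `∂f/∂x`, where `z = x + iy`. -/
def dx (f : ℍ → ℂ) (z : ℍ) : ℂ := fderiv ℝ (f ∘ ofComplex) (z : ℂ) 1

/-- The partial derivative `∂f/∂y`, where `z = x + iy`. -/
def dy (f : ℍ → ℂ) (z : ℍ) : ℂ := fderiv ℝ (f ∘ ofComplex) (z : ℂ) Complex.I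

/-- The (weight zero) hyperbolic Laplacian `y² (∂²/∂x² + ∂²/∂y²)`. -/
def laplacian (f : ℍ → ℂ) (z : ℍ) : ℂ :=
  ((z.im ^ 2 : ℝ) : ℂ) * (dx (dx f) z + dy (dy f) z)

/-- The raising operator `K_k = k/2 + y (i ∂/∂x + ∂/∂y)`. -/
def raising (k : ℕ) (f : ℍ → ℂ) (z : ℍ) : ℂ :=
  (k : ℂ) / 2 * f z + (z.im : ℂ) * (Complex.I * dx f z + dy f z)

/-- The composite `K_{2m-2} ⋯ K_2 K_0 f`, of weight `2m`. -/
def iterRaising (f : ℍ → ℂ) : ℕ → ℍ → ℂ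
  | 0 => f
  | m + 1 => raising (2 * m) (iterRaising f m)

/-- `λ(s) = s (1 - s)`, for real `s`. -/
def lam (s : ℝ) : ℝ := s * (1 - s)

/-- The normalised raised form of even weight `k`,
`u_k = ∏_{0 ≤ l < k/2} (1/4 + t² - λ(-l))^{-1/2} K_{2l} u`,
for `u` of weight zero and eigenvalue `1/4 + t²`. -/
def raisedForm (t : ℝ) (u : ℍ → ℂ) (k : ℕ) (z : ℍ) : ℂ :=
  ((∏ l ∈ Finset.range (k / 2), (Real.sqrt (1 / 4 + t ^ 2 - lam (-(l : ℝ))))⁻¹ : ℝ) : ℂ) *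
    iterRaising u (k / 2) z

/-- The Fourier coefficient `a_n(y) = ∫₀¹ f(x + iy) e(-nx) dx` of a one-periodic function,
where `e(x) = exp(2πix)`. -/
def fourierCoeffAt (f : ℍ → ℂ) (n : ℤ) (y : ℝ) : ℂ :=
  ∫ x in (0 : ℝ)..1, f (ofComplex ((x : ℂ) + (y : ℂ) * Complex.I)) *
    Complex.exp (-(2 * (Real.pi : ℂ) * Complex.I * (n : ℂ) * (x : ℂ)))

/-- A Maass cusp form of weight zero for `SL₂(ℤ)` with eigenvalue `1/4 + t²`: a smooth,
`SL₂(ℤ)`-invariant function, square-integrable on the modular surface for `dx dy / y²`, with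
`Δu = -(1/4 + t²) u` and vanishing zeroth Fourier coefficient. -/
structure IsMaassCuspForm (t : ℝ) (u : ℍ → ℂ) : Prop where
  smooth : IsSmooth u
  invariant : ∀ (γ : Matrix.SpecialLinearGroup (Fin 2) ℤ) (z : ℍ), u (γ • z) = u z
  square_integrable : MeasureTheory.MemLp u 2 (MeasureTheory.volume.restrict ModularGroup.fd)
  eigen : ∀ z : ℍ, laplacian u z = -((1 / 4 + t ^ 2 : ℝ) : ℂ) * u z
  cuspidal : ∀ y : ℝ, 0 < y → fourierCoeffAt u 0 y = 0

/-- `u` is even: `u(-z̄) = u(z)`. -/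
def IsEvenForm (u : ℍ → ℂ) : Prop :=
  ∀ z : ℍ, u (ofComplex (-(starRingEnd ℂ) (z : ℂ))) = u z

/-- `u` is odd: `u(-z̄) = -u(z)`. -/
def IsOddForm (u : ℍ → ℂ) : Prop :=
  ∀ z : ℍ, u (ofComplex (-(starRingEnd ℂ) (z : ℂ))) = -u z

/-- The modified Bessel function `K_ν(x) = ∫₀^∞ exp(-x cosh v) cosh(νv) dv`, for `x > 0`. -/
def besselK (ν : ℂ) (x : ℝ) : ℂ :=
  ∫ v in Set.Ioi (0 : ℝ), (Real.exp (-(x * Real.cosh v)) : ℂ) * Complex.cosh (ν * (v : ℂ))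

/-- The Whittaker function `W_{0,ν}(y) = √(y/π) K_ν(y/2)`, for `y > 0`. -/
def whittakerZero (ν : ℂ) (y : ℝ) : ℂ :=
  (Real.sqrt (y / Real.pi) : ℂ) * besselK ν (y / 2)

/-- The numbers `c(n)`, `n ≠ 0`, are the coefficients of `u` in its Fourier expansion
`u(z) = ∑_{n ≠ 0} c(n) / √|n| · W_{0,it}(4π|n|y) e(nx)`. -/
def IsFourierWhittaker (t : ℝ) (u : ℍ → ℂ) (c : ℤ → ℂ) : Prop :=
  ∀ n : ℤ, n ≠ 0 → ∀ y : ℝ, 0 < y →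
    fourierCoeffAt u n y =
      c n / (Real.sqrt |(n : ℝ)| : ℂ) *
        whittakerZero (Complex.I * (t : ℂ)) (4 * Real.pi * |(n : ℝ)| * y)

end MaassRaised

end

/-! Put `s = 1/2 + it`. Integrating the Laplace equation against `e(-nx)` shows that the `n`-th
coefficient of `u` solves `b'' = ((2πn)² - (1/4 + t²)/y²) b`. One solution is `√y K_{it}(2π|n|y)`,
which decays exponentially. Square-integrability on the fundamental domain makes the means of `|b|`
over `[Y, Y+1]` grow at most polynomially. The constant Wronskian of `b` with the decaying solution
is therefore zero, and `b` is a multiple of that solution (`exists_eq_const_mul_of_decay`,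
`IsMaassCuspForm.exists_coeff`).

To follow the raising operators, the Bessel function is replaced by an oscillatory integral. Let
`J_m(Y)` be the integral of `(1+v²)^{-s} ((v-i)/(v+i))^m e(-Yv)` over the real line. A Gamma
integral and a Gaussian Fourier transform identify `√y K_{it}(2π|n|y)` with `y^{1-s} J_0(ny)`, up to
a constant controlled by `|Γ(s)| ≤ √π` (`Gamma_mul_oscIntegral_zero`, `two_mul_besselSol_eq`). On
`n`-th coefficients `K_{2m}` is the operator `m - 2πny + y d/dy`, and it sends `y^{1-s} J_m(ny)` to
`(s+m) y^{1-s} J_{m+1}(ny)` (`hasDerivAt_oscIntegral`). Since `|s+l|² = 1/4 + t² - λ(-l)`, the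
normalising product cancels these factors exactly in absolute value. What remains is `|a_n(y)| ≤
|c(n)| √y |J_{k/2}(ny)|` (`norm_fourierCoeffAt_raisedForm_le`).

The twist `((v-i)/(v+i))^m` is unimodular, and every derivative of the integrand costs a factor
`O(1+|t|+m)` and gains a factor `(1+v²)^{-1/2}`. For `A ≥ 1`, `A` integrations by parts give the
bound (`norm_oscIntegral_le`). For `A = 0` the integrand has size `1/|v|`, and cutting at `|v| = T`
with `T` of size `(1+|t|+m)/|Y|` leaves a logarithm (`norm_oscIntegral_le_arsinh`). It is bounded by
an `ε`-th power, and the resulting `k^ε` is absorbed in `2^k`.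

The bound holds for `a_n` and `a_{-n}` separately, so the sum needs only the triangle inequality.
Parity serves to give `|c(-n)| = |c(n)|`. -/

namespace MaassRaised

/-! ### Fourier coefficients under differentiation, raising and reflection -/

open MeasureTheory

/-- Invariance under `z ↦ z + 1`. -/
def IsPeriodic (f : ℍ → ℂ) : Prop :=
  ∀ w : ℂ, 0 < w.im → f (ofComplex (w + 1)) = f (ofComplex w)

lemma isOpen_im_pos : IsOpen {z : ℂ | 0 < z.im} := isOpen_lt continuous_const Complex.continuous_im

lemma coe_ofComplex_of_im_pos {w : ℂ} (hw : 0 < w.im) : ((ofComplex w : ℍ) : ℂ) = w := by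
  rw [ofComplex_apply_of_im_pos hw]

lemma add_mul_I_im (x y : ℝ) : ((x : ℂ) + (y : ℂ) * Complex.I).im = y := by simp

lemma IsSmooth.differentiableAt {f : ℍ → ℂ} (hf : IsSmooth f) {w : ℂ} (hw : 0 < w.im) :
    DifferentiableAt ℝ (f ∘ ofComplex) w :=
  (hf.differentiableOn (by simp)).differentiableAt (isOpen_im_pos.mem_nhds hw)

lemma IsSmooth.fderiv_apply {f : ℍ → ℂ} (hf : IsSmooth f) (v : ℂ) :
    IsSmooth fun z ↦ fderiv ℝ (f ∘ ofComplex) (z : ℂ) v := by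
  have h : ContDiffOn ℝ ∞ (fun w ↦ fderiv ℝ (f ∘ ofComplex) w v) {z : ℂ | 0 < z.im} :=
    (hf.fderiv_of_isOpen isOpen_im_pos (by simp)).clm_apply contDiffOn_const
  refine h.congr fun w hw ↦ ?_
  simp only [Function.comp_apply]
  rw [coe_ofComplex_of_im_pos hw]

lemma IsSmooth.dx {f : ℍ → ℂ} (hf : IsSmooth f) : IsSmooth (dx f) := hf.fderiv_apply 1

lemma IsSmooth.dy {f : ℍ → ℂ} (hf : IsSmooth f) : IsSmooth (dy f) := hf.fderiv_apply Complex.I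

lemma IsSmooth.raising {f : ℍ → ℂ} (hf : IsSmooth f) (k : ℕ) : IsSmooth (raising k f) := by
  have him : ContDiffOn ℝ ∞ (fun w : ℂ ↦ ((w.im : ℝ) : ℂ)) {z : ℂ | 0 < z.im} :=
    (Complex.ofRealCLM.contDiff.comp Complex.imCLM.contDiff).contDiffOn
  have h := (contDiffOn_const (c := (k : ℂ) / 2)).mul hf |>.add
    (him.mul ((contDiffOn_const (c := Complex.I)).mul hf.dx |>.add hf.dy))
  refine h.congr fun w hw ↦ ?_
  simp only [Function.comp_apply, MaassRaised.raising]
  rw [← UpperHalfPlane.coe_im, coe_ofComplex_of_im_pos hw]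

lemma IsPeriodic.fderiv_apply {f : ℍ → ℂ} (hf : IsPeriodic f) (v : ℂ) :
    IsPeriodic fun z ↦ fderiv ℝ (f ∘ ofComplex) (z : ℂ) v := by
  intro w hw
  have hw' : 0 < (w + 1).im := by simpa using hw
  simp only
  rw [coe_ofComplex_of_im_pos hw, coe_ofComplex_of_im_pos hw', ← fderiv_comp_add_right]
  congr 1
  refine Filter.EventuallyEq.fderiv_eq ?_
  filter_upwards [isOpen_im_pos.mem_nhds hw] with z hz
  exact hf z hz

lemma IsPeriodic.raising {f : ℍ → ℂ} (hf : IsPeriodic f) (k : ℕ) :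
    IsPeriodic (raising k f) := by
  intro w hw
  have hw' : 0 < (w + 1).im := by simpa using hw
  have h1 := hf.fderiv_apply 1 w hw
  have h2 := hf.fderiv_apply Complex.I w hw
  simp only [MaassRaised.raising, dx, dy] at h1 h2 ⊢
  rw [h1, h2, hf w hw, ← UpperHalfPlane.coe_im, ← UpperHalfPlane.coe_im,
    coe_ofComplex_of_im_pos hw, coe_ofComplex_of_im_pos hw']
  simp

lemma IsSmooth.hasDerivAt_x {f : ℍ → ℂ} (hf : IsSmooth f) (x : ℝ) {y : ℝ} (hy : 0 < y) :
    HasDerivAt (fun x : ℝ ↦ f (ofComplex ((x : ℂ) + (y : ℂ) * Complex.I)))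
      (MaassRaised.dx f (ofComplex ((x : ℂ) + (y : ℂ) * Complex.I))) x := by
  have hw : 0 < ((x : ℂ) + (y : ℂ) * Complex.I).im := by rwa [add_mul_I_im]
  have h1 : HasDerivAt (fun x : ℝ ↦ (x : ℂ) + (y : ℂ) * Complex.I) 1 x :=
    (Complex.ofRealCLM.hasDerivAt (x := x)).add_const _
  have := (hf.differentiableAt hw).hasFDerivAt.comp_hasDerivAt x h1
  rw [MaassRaised.dx, coe_ofComplex_of_im_pos hw]
  exact this

lemma IsSmooth.hasDerivAt_y {f : ℍ → ℂ} (hf : IsSmooth f) (x : ℝ) {y : ℝ} (hy : 0 < y) :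
    HasDerivAt (fun y : ℝ ↦ f (ofComplex ((x : ℂ) + (y : ℂ) * Complex.I)))
      (MaassRaised.dy f (ofComplex ((x : ℂ) + (y : ℂ) * Complex.I))) y := by
  have hw : 0 < ((x : ℂ) + (y : ℂ) * Complex.I).im := by rwa [add_mul_I_im]
  have h1 : HasDerivAt (fun y : ℝ ↦ (x : ℂ) + (y : ℂ) * Complex.I) Complex.I y := by
    simpa using ((Complex.ofRealCLM.hasDerivAt (x := y)).mul_const Complex.I).const_add (x : ℂ)
  have := (hf.differentiableAt hw).hasFDerivAt.comp_hasDerivAt y h1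
  rw [MaassRaised.dy, coe_ofComplex_of_im_pos hw]
  exact this

lemma IsSmooth.continuousOn_prod {f : ℍ → ℂ} (hf : IsSmooth f) :
    ContinuousOn (fun p : ℝ × ℝ ↦ f (ofComplex ((p.1 : ℂ) + (p.2 : ℂ) * Complex.I)))
      {p | 0 < p.2} := by
  have h : ContinuousOn (f ∘ ofComplex) {z : ℂ | 0 < z.im} := hf.continuousOn
  refine h.comp (f := fun p : ℝ × ℝ ↦ (p.1 : ℂ) + (p.2 : ℂ) * Complex.I) (by fun_prop) ?_
  intro p hp
  simpa using hp

lemma IsSmooth.continuous_x {f : ℍ → ℂ} (hf : IsSmooth f) {y : ℝ} (hy : 0 < y) :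
    Continuous (fun x : ℝ ↦ f (ofComplex ((x : ℂ) + (y : ℂ) * Complex.I))) :=
  continuous_iff_continuousAt.2 fun x ↦ (hf.hasDerivAt_x x hy).continuousAt

/-- The character `x ↦ e(-nx)`. -/
noncomputable def negChar (n : ℤ) (x : ℝ) : ℂ :=
  Complex.exp (-(2 * (Real.pi : ℂ) * Complex.I * (n : ℂ) * (x : ℂ)))

lemma continuous_negChar (n : ℤ) : Continuous (negChar n) := by
  unfold negChar; fun_prop

lemma norm_negChar (n : ℤ) (x : ℝ) : ‖negChar n x‖ = 1 := by
  have : -(2 * (Real.pi : ℂ) * Complex.I * (n : ℂ) * (x : ℂ)) =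
      ((-(2 * Real.pi * n * x) : ℝ) : ℂ) * Complex.I := by push_cast; ring
  rw [negChar, this, Complex.norm_exp_ofReal_mul_I]

lemma negChar_add_one (n : ℤ) (x : ℝ) : negChar n (x + 1) = negChar n x := by
  unfold negChar
  rw [Complex.exp_eq_exp_iff_exists_int]
  exact ⟨-n, by push_cast; ring⟩

lemma hasDerivAt_negChar (n : ℤ) (x : ℝ) :
    HasDerivAt (negChar n) (-(2 * Real.pi * Complex.I * n) * negChar n x) x := by
  have h : HasDerivAt (fun x : ℝ ↦ -(2 * (Real.pi : ℂ) * Complex.I * (n : ℂ) * (x : ℂ)))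
      (-(2 * (Real.pi : ℂ) * Complex.I * (n : ℂ))) x := by
    have := ((Complex.ofRealCLM.hasDerivAt (x := x)).const_mul
      (2 * (Real.pi : ℂ) * Complex.I * (n : ℂ))).neg
    rw [Complex.ofRealCLM_apply, Complex.ofReal_one, mul_one] at this
    exact this
  exact h.cexp.congr_deriv (mul_comm _ _)

lemma fourierCoeffAt_eq (f : ℍ → ℂ) (n : ℤ) (y : ℝ) :
    fourierCoeffAt f n y = ∫ x in (0 : ℝ)..1,
      f (ofComplex ((x : ℂ) + (y : ℂ) * Complex.I)) * negChar n x := rfl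

lemma fourierCoeffAt_dx {f : ℍ → ℂ} (hf : IsSmooth f) (hp : IsPeriodic f) (n : ℤ) {y : ℝ}
    (hy : 0 < y) :
    fourierCoeffAt (dx f) n y = 2 * Real.pi * Complex.I * n * fourierCoeffAt f n y := by
  have hp1 : f (ofComplex (((1 : ℝ) : ℂ) + (y : ℂ) * Complex.I)) =
      f (ofComplex (((0 : ℝ) : ℂ) + (y : ℂ) * Complex.I)) := by
    rw [← hp (((0 : ℝ) : ℂ) + (y : ℂ) * Complex.I) (by rwa [add_mul_I_im])]
    congr 2; push_cast; ring
  have hc1 : negChar n 1 = negChar n 0 := by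
    simpa using negChar_add_one n 0
  have h := intervalIntegral.integral_mul_deriv_eq_deriv_mul (a := (0 : ℝ)) (b := 1)
    (u := negChar n) (v := fun x : ℝ ↦ f (ofComplex ((x : ℂ) + (y : ℂ) * Complex.I)))
    (fun x _ ↦ hasDerivAt_negChar n x) (fun x _ ↦ hf.hasDerivAt_x x hy)
    (Continuous.intervalIntegrable (continuous_const.mul (continuous_negChar n)) _ _)
    ((hf.dx.continuous_x hy).intervalIntegrable _ _)
  rw [hp1, hc1, sub_self, zero_sub, ← intervalIntegral.integral_neg] at h
  rw [fourierCoeffAt_eq, fourierCoeffAt_eq, ← intervalIntegral.integral_const_mul]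
  refine Eq.trans ?_ (h.trans ?_)
  · exact intervalIntegral.integral_congr fun x _ ↦ mul_comm _ _
  · refine intervalIntegral.integral_congr fun x _ ↦ ?_
    ring

lemma hasDerivAt_fourierCoeffAt {f : ℍ → ℂ} (hf : IsSmooth f) (n : ℤ) {y : ℝ} (hy : 0 < y) :
    HasDerivAt (fourierCoeffAt f n) (fourierCoeffAt (dy f) n y) y := by
  -- Differentiation under the integral: `dy f` is bounded on this compact set, and a constant is
  -- integrable over `[0,1]`.
  have hK : IsCompact (Set.Icc (0 : ℝ) 1 ×ˢ Set.Icc (y / 2) (2 * y)) :=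
    isCompact_Icc.prod isCompact_Icc
  have hsub : Set.Icc (0 : ℝ) 1 ×ˢ Set.Icc (y / 2) (2 * y) ⊆ {p : ℝ × ℝ | 0 < p.2} := by
    rintro ⟨a, b⟩ ⟨-, hb⟩
    exact lt_of_lt_of_le (by positivity) hb.1
  obtain ⟨B, hB⟩ := hK.exists_bound_of_continuousOn (hf.dy.continuousOn_prod.mono hsub)
  refine (intervalIntegral.hasDerivAt_integral_of_dominated_loc_of_deriv_le (μ := volume)
    (s := Set.Icc (y / 2) (2 * y)) (bound := fun _ ↦ B)
    (F := fun (y x : ℝ) ↦ f (ofComplex ((x : ℂ) + (y : ℂ) * Complex.I)) * negChar n x)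
    (F' := fun (y x : ℝ) ↦ dy f (ofComplex ((x : ℂ) + (y : ℂ) * Complex.I)) * negChar n x)
    (Icc_mem_nhds (by linarith) (by linarith)) ?_ ?_ ?_ ?_ ?_ ?_).2
  · filter_upwards [lt_mem_nhds hy] with y' hy'
    exact ((hf.continuous_x hy').mul (continuous_negChar n)).aestronglyMeasurable
  · exact ((hf.continuous_x hy).mul (continuous_negChar n)).intervalIntegrable _ _
  · exact ((hf.dy.continuous_x hy).mul (continuous_negChar n)).aestronglyMeasurable
  · refine Filter.Eventually.of_forall fun x hx y' hy' ↦ ?_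
    rw [Set.uIoc_of_le zero_le_one] at hx
    rw [norm_mul, norm_negChar, mul_one]
    exact hB (x, y') ⟨⟨hx.1.le, hx.2⟩, hy'⟩
  · exact intervalIntegrable_const
  · refine Filter.Eventually.of_forall fun x _ y' hy' ↦ ?_
    exact (hf.hasDerivAt_y x (lt_of_lt_of_le (by positivity) hy'.1)).mul_const _

/-- Integration by parts turns `∂/∂x` into `2πin`, so `iy ∂/∂x` acts as `-2πny`. Raising becomes a
first-order operator in `y` alone. -/
lemma fourierCoeffAt_raising {f : ℍ → ℂ} (hf : IsSmooth f) (hp : IsPeriodic f) (k : ℕ) (n : ℤ)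
    {y : ℝ} (hy : 0 < y) :
    fourierCoeffAt (raising k f) n y =
      ((k : ℂ) / 2 - 2 * Real.pi * n * y) * fourierCoeffAt f n y +
        y * fourierCoeffAt (dy f) n y := by
  have hi : ∀ {g : ℍ → ℂ}, IsSmooth g → IntervalIntegrable
      (fun x : ℝ ↦ g (ofComplex ((x : ℂ) + (y : ℂ) * Complex.I)) * negChar n x) volume 0 1 :=
    fun hg ↦ ((hg.continuous_x hy).mul (continuous_negChar n)).intervalIntegrable _ _
  have key : fourierCoeffAt (raising k f) n y = (k : ℂ) / 2 * fourierCoeffAt f n y +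
      (y * Complex.I * fourierCoeffAt (dx f) n y + y * fourierCoeffAt (dy f) n y) := by
    simp only [fourierCoeffAt_eq]
    rw [← intervalIntegral.integral_const_mul, ← intervalIntegral.integral_const_mul,
      ← intervalIntegral.integral_const_mul,
      ← intervalIntegral.integral_add ((hi hf.dx).const_mul _) ((hi hf.dy).const_mul _),
      ← intervalIntegral.integral_add ((hi hf).const_mul _)
        (((hi hf.dx).const_mul _).add ((hi hf.dy).const_mul _))]
    refine intervalIntegral.integral_congr fun x _ ↦ ?_
    simp only [raising]
    rw [← UpperHalfPlane.coe_im, coe_ofComplex_of_im_pos (by rwa [add_mul_I_im]), add_mul_I_im]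
    ring
  rw [key, fourierCoeffAt_dx hf hp n hy]
  linear_combination (2 * Real.pi * n * y * fourierCoeffAt f n y) * Complex.I_sq

lemma fourierCoeffAt_laplacian {f : ℍ → ℂ} (hf : IsSmooth f) (hp : IsPeriodic f) (n : ℤ)
    {y : ℝ} (hy : 0 < y) :
    fourierCoeffAt (laplacian f) n y =
      y ^ 2 * (fourierCoeffAt (dy (dy f)) n y - (2 * Real.pi * n) ^ 2 * fourierCoeffAt f n y) := by
  have hi : ∀ {g : ℍ → ℂ}, IsSmooth g → IntervalIntegrable
      (fun x : ℝ ↦ g (ofComplex ((x : ℂ) + (y : ℂ) * Complex.I)) * negChar n x) volume 0 1 :=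
    fun hg ↦ ((hg.continuous_x hy).mul (continuous_negChar n)).intervalIntegrable _ _
  have key : fourierCoeffAt (laplacian f) n y = y ^ 2 *
      (fourierCoeffAt (dx (dx f)) n y + fourierCoeffAt (dy (dy f)) n y) := by
    simp only [fourierCoeffAt_eq]
    rw [← intervalIntegral.integral_add (hi hf.dx.dx) (hi hf.dy.dy),
      ← intervalIntegral.integral_const_mul]
    refine intervalIntegral.integral_congr fun x _ ↦ ?_
    simp only [laplacian]
    rw [← UpperHalfPlane.coe_im, coe_ofComplex_of_im_pos (by rwa [add_mul_I_im]), add_mul_I_im]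
    push_cast
    ring
  rw [key, fourierCoeffAt_dx hf.dx (hp.fderiv_apply 1) n hy, fourierCoeffAt_dx hf hp n hy]
  linear_combination (y ^ 2 * (2 * Real.pi * n) ^ 2 * fourierCoeffAt f n y) * Complex.I_sq

lemma fourierCoeffAt_const_mul (f : ℍ → ℂ) (a : ℂ) (n : ℤ) (y : ℝ) :
    fourierCoeffAt (fun z ↦ a * f z) n y = a * fourierCoeffAt f n y := by
  rw [fourierCoeffAt_eq, fourierCoeffAt_eq, ← intervalIntegral.integral_const_mul]
  simp only [mul_assoc]

lemma IsMaassCuspForm.isPeriodic {t : ℝ} {u : ℍ → ℂ} (hu : IsMaassCuspForm t u) :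
    IsPeriodic u := by
  intro w hw
  rw [← hu.invariant ModularGroup.T (ofComplex w)]
  congr 1
  rw [UpperHalfPlane.modular_T_smul]
  ext
  have hw' : 0 < (w + 1).im := by simpa using hw
  rw [coe_ofComplex_of_im_pos hw', UpperHalfPlane.coe_vadd, coe_ofComplex_of_im_pos hw]
  push_cast; ring

lemma IsMaassCuspForm.fourierCoeffAt_dy_dy {t : ℝ} {u : ℍ → ℂ} (hu : IsMaassCuspForm t u) (n : ℤ)
    {y : ℝ} (hy : 0 < y) :
    fourierCoeffAt (dy (dy u)) n y =
      (((2 * Real.pi * n) ^ 2 - (1 / 4 + t ^ 2) / y ^ 2 : ℝ) : ℂ) * fourierCoeffAt u n y := by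
  have h := fourierCoeffAt_laplacian hu.smooth hu.isPeriodic n hy
  rw [show laplacian u = fun z ↦ -((1 / 4 + t ^ 2 : ℝ) : ℂ) * u z from funext hu.eigen,
    fourierCoeffAt_const_mul] at h
  have hy' : (y : ℂ) ≠ 0 := by exact_mod_cast hy.ne'
  push_cast at h ⊢
  field_simp at h ⊢
  linear_combination -h

lemma isSmooth_iterRaising {f : ℍ → ℂ} (hf : IsSmooth f) : ∀ m, IsSmooth (iterRaising f m)
  | 0 => hf
  | m + 1 => (isSmooth_iterRaising hf m).raising _

lemma isPeriodic_iterRaising {f : ℍ → ℂ} (hf : IsPeriodic f) : ∀ m, IsPeriodic (iterRaising f m)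
  | 0 => hf
  | m + 1 => (isPeriodic_iterRaising hf m).raising _

lemma fourierCoeffAt_iterRaising_succ {f : ℍ → ℂ} (hf : IsSmooth f) (hp : IsPeriodic f) (m : ℕ)
    (n : ℤ) {y : ℝ} (hy : 0 < y) :
    fourierCoeffAt (iterRaising f (m + 1)) n y =
      (m - 2 * Real.pi * n * y) * fourierCoeffAt (iterRaising f m) n y +
        y * deriv (fourierCoeffAt (iterRaising f m) n) y := by
  have hs := isSmooth_iterRaising hf m
  rw [iterRaising, fourierCoeffAt_raising hs (isPeriodic_iterRaising hp m) _ n hy,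
    (hasDerivAt_fourierCoeffAt hs n hy).deriv]
  push_cast
  ring

lemma fourierCoeffAt_zero_iterRaising {f : ℍ → ℂ} (hf : IsSmooth f) (hp : IsPeriodic f)
    (h0 : ∀ y : ℝ, 0 < y → fourierCoeffAt f 0 y = 0) (m : ℕ) :
    ∀ y : ℝ, 0 < y → fourierCoeffAt (iterRaising f m) 0 y = 0 := by
  induction m with
  | zero => exact h0
  | succ m ih =>
    intro y hy
    have h : fourierCoeffAt (iterRaising f m) 0 =ᶠ[nhds y] fun _ ↦ 0 := by
      filter_upwards [lt_mem_nhds hy] with y' hy' using ih y' hy'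
    rw [fourierCoeffAt_iterRaising_succ hf hp m 0 hy, ih y hy, h.deriv_eq]
    simp

/-- For a function with `u(-z̄) = σ u(z)`, the coefficients at `n` and `-n` agree up to `σ`. -/
lemma fourierCoeffAt_neg_of_reflect {u : ℍ → ℂ} (hp : IsPeriodic u) {σ : ℂ}
    (hσ : ∀ z : ℍ, u (ofComplex (-(starRingEnd ℂ) (z : ℂ))) = σ * u z) (n : ℤ) {y : ℝ}
    (hy : 0 < y) : fourierCoeffAt u (-n) y = σ * fourierCoeffAt u n y := by
  rw [fourierCoeffAt_eq, fourierCoeffAt_eq, ← intervalIntegral.integral_const_mul]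
  have h := intervalIntegral.integral_comp_sub_left (a := (0 : ℝ)) (b := 1)
    (fun x : ℝ ↦ u (ofComplex ((x : ℂ) + (y : ℂ) * Complex.I)) * negChar (-n) x) 1
  rw [sub_self, sub_zero] at h
  rw [← h]
  refine intervalIntegral.integral_congr fun x _ ↦ ?_
  have h1 : u (ofComplex (((1 - x : ℝ) : ℂ) + (y : ℂ) * Complex.I)) =
      σ * u (ofComplex ((x : ℂ) + (y : ℂ) * Complex.I)) := by
    -- The reflected point `-x + iy` has to be translated by `1` to become `(1 - x) + iy`.
    rw [← hσ, coe_ofComplex_of_im_pos (by rwa [add_mul_I_im]), 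
      ← hp (-(starRingEnd ℂ) ((x : ℂ) + (y : ℂ) * Complex.I)) (by simpa using hy)]
    congr 2
    simp
    ring
  have h2 : negChar (-n) (1 - x) = negChar n x := by
    unfold negChar
    rw [Complex.exp_eq_exp_iff_exists_int]
    exact ⟨n, by push_cast; ring⟩
  rw [h1, h2, mul_assoc]

end MaassRaised

/-! ### The Bessel function `K_{it}`: differential equation, decay and nonvanishing -/

namespace MaassRaised

open MeasureTheory Set Filter

lemma cosh_I_mul (t v : ℝ) :
    Complex.cosh (Complex.I * (t : ℂ) * (v : ℂ)) = (Real.cos (t * v) : ℂ) := by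
  rw [show Complex.I * (t : ℂ) * (v : ℂ) = ((t * v : ℝ) : ℂ) * Complex.I by push_cast; ring,
    Complex.cosh_mul_I, Complex.ofReal_cos]

lemma sinh_I_mul (t v : ℝ) :
    Complex.sinh (Complex.I * (t : ℂ) * (v : ℂ)) = (Real.sin (t * v) : ℂ) * Complex.I := by
  rw [show Complex.I * (t : ℂ) * (v : ℂ) = ((t * v : ℝ) : ℂ) * Complex.I by push_cast; ring,
    Complex.sinh_mul_I, Complex.ofReal_sin]

lemma norm_cosh_I_mul_le (t v : ℝ) : ‖Complex.cosh (Complex.I * (t : ℂ) * (v : ℂ))‖ ≤ 1 := by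
  rw [cosh_I_mul, Complex.norm_real]
  exact Real.abs_cos_le_one _

lemma norm_sinh_I_mul_le (t v : ℝ) : ‖Complex.sinh (Complex.I * (t : ℂ) * (v : ℂ))‖ ≤ 1 := by
  rw [sinh_I_mul, norm_mul, Complex.norm_I, mul_one, Complex.norm_real]
  exact Real.abs_sin_le_one _

lemma le_cosh (v : ℝ) : v ≤ Real.cosh v := by
  rcases le_total v 0 with h | h
  · exact h.trans (Real.cosh_pos v).le
  · exact (Real.self_le_sinh_iff.2 h).trans (Real.sinh_lt_cosh v).le

/-- Half of the exponential absorbs the power of `cosh v`. The other half decays in `v` because `v ≤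
cosh v`. -/
lemma cosh_pow_mul_exp_le (j : ℕ) {x : ℝ} (hx : 0 < x) (v : ℝ) :
    Real.cosh v ^ j * Real.exp (-(x * Real.cosh v)) ≤
      j.factorial * (2 / x) ^ j * Real.exp (-(x / 2) * v) := by
  have hc := Real.cosh_pos v
  have h1 : Real.cosh v ^ j ≤ j.factorial * (2 / x) ^ j * Real.exp (x / 2 * Real.cosh v) := by
    have := Real.pow_div_factorial_le_exp (x / 2 * Real.cosh v) (by positivity) j
    rw [div_le_iff₀ (by positivity)] at this
    calc Real.cosh v ^ j = (2 / x) ^ j * (x / 2 * Real.cosh v) ^ j := by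
          rw [← mul_pow]; congr 1; field_simp
      _ ≤ (2 / x) ^ j * (Real.exp (x / 2 * Real.cosh v) * j.factorial) := by gcongr
      _ = _ := by ring
  calc Real.cosh v ^ j * Real.exp (-(x * Real.cosh v))
      ≤ j.factorial * (2 / x) ^ j * Real.exp (x / 2 * Real.cosh v) *
        Real.exp (-(x * Real.cosh v)) := by gcongr
    _ = j.factorial * (2 / x) ^ j * Real.exp (-(x / 2) * Real.cosh v) := by
        rw [mul_assoc, ← Real.exp_add]; congr 2; ring
    _ ≤ _ := by
        gcongr ?_ * Real.exp ?_
        nlinarith [le_cosh v]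

lemma integrableOn_cosh_pow_mul_exp (j : ℕ) {x : ℝ} (hx : 0 < x) :
    IntegrableOn (fun v ↦ Real.cosh v ^ j * Real.exp (-(x * Real.cosh v))) (Ioi 0) := by
  have h := (exp_neg_integrableOn_Ioi 0 (half_pos hx)).const_mul (j.factorial * (2 / x) ^ j)
  refine Integrable.mono' h ?_ (Eventually.of_forall fun v ↦ ?_)
  · have : Continuous (fun v ↦ Real.cosh v ^ j * Real.exp (-(x * Real.cosh v))) := by fun_prop
    exact this.aestronglyMeasurable
  · have := Real.cosh_pos v
    rw [Real.norm_of_nonneg (by positivity)]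
    exact cosh_pow_mul_exp_le j hx v

/-- The integrand of `besselMoment`. -/
noncomputable def besselIntegrand (t : ℝ) (j : ℕ) (x v : ℝ) : ℂ :=
  ((Real.cosh v ^ j * Real.exp (-(x * Real.cosh v)) : ℝ) : ℂ) *
    Complex.cosh (Complex.I * (t : ℂ) * (v : ℂ))

/-- The integral `∫₀^∞ (cosh v)^j exp(-x cosh v) cos(tv) dv`. -/
noncomputable def besselMoment (t : ℝ) (j : ℕ) (x : ℝ) : ℂ :=
  ∫ v in Ioi (0 : ℝ), besselIntegrand t j x v

lemma besselK_eq_besselMoment (t x : ℝ) :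
    besselK (Complex.I * (t : ℂ)) x = besselMoment t 0 x := by
  simp only [besselK, besselMoment, besselIntegrand, pow_zero, one_mul]

lemma continuous_besselIntegrand (t : ℝ) (j : ℕ) (x : ℝ) :
    Continuous (besselIntegrand t j x) := by
  unfold besselIntegrand
  have : Continuous (fun v ↦ Real.cosh v ^ j * Real.exp (-(x * Real.cosh v))) := by fun_prop
  exact (Complex.continuous_ofReal.comp this).mul (by fun_prop)

lemma norm_besselIntegrand_le (t : ℝ) (j : ℕ) (x v : ℝ) :
    ‖besselIntegrand t j x v‖ ≤ Real.cosh v ^ j * Real.exp (-(x * Real.cosh v)) := by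
  have := Real.cosh_pos v
  rw [besselIntegrand, norm_mul, Complex.norm_real, Real.norm_of_nonneg (by positivity)]
  exact mul_le_of_le_one_right (by positivity) (norm_cosh_I_mul_le t v)

lemma integrableOn_besselIntegrand (t : ℝ) (j : ℕ) {x : ℝ} (hx : 0 < x) :
    IntegrableOn (besselIntegrand t j x) (Ioi 0) :=
  Integrable.mono' (integrableOn_cosh_pow_mul_exp j hx)
    (continuous_besselIntegrand t j x).aestronglyMeasurable
    (Eventually.of_forall fun v ↦ norm_besselIntegrand_le t j x v)

lemma hasDerivAt_besselMoment (t : ℝ) (j : ℕ) {x : ℝ} (hx : 0 < x) :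
    HasDerivAt (besselMoment t j) (-besselMoment t (j + 1) x) x := by
  rw [besselMoment, ← integral_neg]
  refine (hasDerivAt_integral_of_dominated_loc_of_deriv_le (μ := volume.restrict (Ioi 0))
    (s := Ioi (x / 2)) (F := fun x v ↦ besselIntegrand t j x v)
    (F' := fun x v ↦ -besselIntegrand t (j + 1) x v)
    (bound := fun v ↦ Real.cosh v ^ (j + 1) * Real.exp (-(x / 2 * Real.cosh v)))
    (Ioi_mem_nhds (by linarith)) ?_ ?_ ?_ ?_ ?_ ?_).2
  · exact Eventually.of_forall fun x' ↦ (continuous_besselIntegrand t j x').aestronglyMeasurable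
  · exact integrableOn_besselIntegrand t j hx
  · exact (continuous_besselIntegrand t (j + 1) x).neg.aestronglyMeasurable
  · refine Eventually.of_forall fun v x' hx' ↦ ?_
    have := Real.cosh_pos v
    rw [norm_neg]
    refine (norm_besselIntegrand_le t (j + 1) x' v).trans ?_
    have : x / 2 ≤ x' := le_of_lt hx'
    gcongr
  · exact integrableOn_cosh_pow_mul_exp (j + 1) (half_pos hx)
  · refine Eventually.of_forall fun v x' hx' ↦ ?_
    have h1 : HasDerivAt (fun x : ℝ ↦ Real.cosh v ^ j * Real.exp (-(x * Real.cosh v)))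
        (-(Real.cosh v ^ (j + 1) * Real.exp (-(x' * Real.cosh v)))) x' := by
      have := (((hasDerivAt_id x').mul_const (Real.cosh v)).neg.exp).const_mul (Real.cosh v ^ j)
      refine this.congr_deriv ?_
      simp only [id, Pi.neg_apply]
      ring
    refine (h1.ofReal_comp.mul_const
      (Complex.cosh (Complex.I * (t : ℂ) * (v : ℂ)))).congr_deriv ?_
    rw [besselIntegrand]
    push_cast
    ring

lemma norm_besselMoment_le (t : ℝ) (j : ℕ) {x : ℝ} (hx : 1 ≤ x) :
    ‖besselMoment t j x‖ ≤ Real.exp (-(x - 1)) *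
      ∫ v in Ioi (0 : ℝ), Real.cosh v ^ j * Real.exp (-(1 * Real.cosh v)) := by
  rw [besselMoment, ← integral_const_mul]
  refine norm_integral_le_of_norm_le
    ((integrableOn_cosh_pow_mul_exp j one_pos).const_mul _) (Eventually.of_forall fun v ↦ ?_)
  refine (norm_besselIntegrand_le t j x v).trans ?_
  have hc := Real.one_le_cosh v
  rw [mul_left_comm, ← Real.exp_add]
  gcongr
  nlinarith

/-- The modified Bessel equation. -/
lemma besselMoment_ode (t : ℝ) {x : ℝ} (hx : 0 < x) :
    (x : ℂ) ^ 2 * besselMoment t 2 x = x * besselMoment t 1 x +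
      ((x : ℂ) ^ 2 - (t : ℂ) ^ 2) * besselMoment t 0 x := by
  -- The combination of integrands in the Bessel equation is the exact derivative of `P`, which
  -- vanishes at `0` and at infinity.
  set P : ℝ → ℂ := fun v ↦ -((Real.exp (-(x * Real.cosh v)) : ℝ) : ℂ) *
    (x * (Real.sinh v : ℝ) * Complex.cosh (Complex.I * t * v) +
      Complex.I * t * Complex.sinh (Complex.I * t * v)) with hP
  have hder : ∀ v : ℝ, HasDerivAt P ((x : ℂ) ^ 2 * besselIntegrand t 2 x v -
      (x * besselIntegrand t 1 x v +
        ((x : ℂ) ^ 2 - (t : ℂ) ^ 2) * besselIntegrand t 0 x v)) v := by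
    intro v
    have he : HasDerivAt (fun v : ℝ ↦ ((Real.exp (-(x * Real.cosh v)) : ℝ) : ℂ))
        (((Real.exp (-(x * Real.cosh v)) * -(x * Real.sinh v) : ℝ)) : ℂ) v :=
      (((Real.hasDerivAt_cosh v).const_mul x).neg.exp).ofReal_comp
    have hs : HasDerivAt (fun v : ℝ ↦ (x : ℂ) * ((Real.sinh v : ℝ) : ℂ))
        (x * (Real.cosh v : ℝ)) v := (Real.hasDerivAt_sinh v).ofReal_comp.const_mul _
    have hl : HasDerivAt (fun v : ℝ ↦ Complex.I * t * (v : ℂ)) (Complex.I * t) v := by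
      simpa using (Complex.ofRealCLM.hasDerivAt (x := v)).const_mul (Complex.I * t)
    have := he.neg.mul ((hs.mul ((Complex.hasDerivAt_cosh _).comp v hl)).add
      (((Complex.hasDerivAt_sinh _).comp v hl).const_mul (Complex.I * t)))
    refine this.congr_deriv ?_
    simp only [besselIntegrand, Pi.neg_apply, Pi.add_apply, Pi.mul_apply, Function.comp_apply]
    have hsq : ((Real.sinh v : ℝ) : ℂ) ^ 2 = ((Real.cosh v : ℝ) : ℂ) ^ 2 - 1 := by
      rw [← Complex.ofReal_pow, Real.sinh_sq]; push_cast; ring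
    push_cast at hsq ⊢
    linear_combination (((x : ℂ) ^ 2 * Complex.exp (-(x * Complex.cosh v)) *
      Complex.cosh (Complex.I * t * v)) * hsq - (Complex.exp (-(x * Complex.cosh v)) * t ^ 2 *
      Complex.cosh (Complex.I * t * v)) * Complex.I_sq)
  have h0 : P 0 = 0 := by simp [hP]
  have hlim : Tendsto P atTop (nhds 0) := by
    have hb : ∀ v : ℝ, ‖P v‖ ≤ (x * (2 / x) + |t|) * Real.exp (-(x / 2) * v) := by
      intro v
      have hc := Real.cosh_pos v
      have h1 := cosh_pow_mul_exp_le 1 hx v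
      have h2 := cosh_pow_mul_exp_le 0 hx v
      simp only [pow_one, Nat.factorial_one, Nat.cast_one, one_mul, pow_zero, Nat.factorial_zero,
        mul_one] at h1 h2
      have hsc : |Real.sinh v| ≤ Real.cosh v := by
        rw [abs_le]
        constructor
        · have := Real.sinh_lt_cosh (-v)
          rw [Real.sinh_neg, Real.cosh_neg] at this
          linarith
        · exact (Real.sinh_lt_cosh v).le
      calc ‖P v‖ = Real.exp (-(x * Real.cosh v)) * ‖x * (Real.sinh v : ℝ) *
            Complex.cosh (Complex.I * t * v) +
            Complex.I * t * Complex.sinh (Complex.I * t * v)‖ := by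
            rw [hP]; simp only
            rw [norm_mul, norm_neg, Complex.norm_real, Real.norm_of_nonneg (Real.exp_pos _).le]
        _ ≤ Real.exp (-(x * Real.cosh v)) * (x * Real.cosh v * 1 + |t| * 1) := by
            gcongr
            refine (norm_add_le _ _).trans (add_le_add ?_ ?_)
            · rw [norm_mul, norm_mul, Complex.norm_real, Complex.norm_real,
                Real.norm_of_nonneg hx.le]
              gcongr
              · exact hsc
              · exact norm_cosh_I_mul_le t v
            · rw [norm_mul, norm_mul, Complex.norm_I, one_mul, Complex.norm_real, Real.norm_eq_abs]
              gcongr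
              exact norm_sinh_I_mul_le t v
        _ = x * (Real.cosh v * Real.exp (-(x * Real.cosh v))) +
            |t| * Real.exp (-(x * Real.cosh v)) := by ring
        _ ≤ x * (2 / x * Real.exp (-(x / 2) * v)) + |t| * Real.exp (-(x / 2) * v) := by gcongr
        _ = _ := by ring
    refine squeeze_zero_norm hb ?_
    have : Tendsto (fun v : ℝ ↦ Real.exp (-(x / 2) * v)) atTop (nhds 0) :=
      Real.tendsto_exp_atBot.comp (tendsto_id.const_mul_atTop_of_neg (by linarith))
    simpa using this.const_mul (x * (2 / x) + |t|)
  have i2 := (integrableOn_besselIntegrand t 2 hx).const_mul ((x : ℂ) ^ 2)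
  have i1 := (integrableOn_besselIntegrand t 1 hx).const_mul (x : ℂ)
  have i0 := (integrableOn_besselIntegrand t 0 hx).const_mul ((x : ℂ) ^ 2 - (t : ℂ) ^ 2)
  have key := integral_Ioi_of_hasDerivAt_of_tendsto (hder 0).continuousAt.continuousWithinAt
    (fun v _ ↦ hder v) (i2.sub (i1.add i0)) hlim
  rw [h0, sub_zero] at key
  have e := (integral_sub i2 (i1.add i0)).symm.trans key
  have e' := integral_add i1 i0
  simp only [Pi.add_apply] at e
  rw [e', integral_const_mul, integral_const_mul, integral_const_mul, sub_eq_zero] at e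
  exact e

/-- Laplace's method: for large `x` the weight `exp(-x cosh v)` concentrates near `v = 0`, where
`cos(tv)` is at least `1/2`. One such point is enough to fix the proportionality constant between
two solutions. -/
lemma exists_besselMoment_ne_zero (t : ℝ) : ∃ x : ℝ, 0 < x ∧ besselMoment t 0 x ≠ 0 := by
  set δ : ℝ := 1 / (1 + |t|) with hδ
  have hδ0 : 0 < δ := by positivity
  set c₁ := Real.cosh (δ / 2)
  set c₂ := Real.cosh δ
  have hc : c₁ < c₂ := Real.cosh_lt_cosh.2 (by
    rw [abs_of_pos hδ0, abs_of_pos (half_pos hδ0)]; linarith)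
  set M := ∫ v in Ioi (0 : ℝ), Real.cosh v ^ 0 * Real.exp (-(1 * Real.cosh v)) with hM
  -- For `v ≤ δ` one has `|tv| ≤ 1`, hence `cos(tv) ≥ 1/2`. Only `v ≤ δ/2` is kept as the main term.
  -- The part `v > δ` is bounded by splitting off `exp(-(x-1)c₂)`.
  have hlow : ∀ x : ℝ, 1 ≤ x →
      δ / 2 * (1 / 2 * Real.exp (-(x * c₁))) - Real.exp (-((x - 1) * c₂)) * M ≤
        (besselMoment t 0 x).re := by
    intro x hx
    have hx0 : 0 < x := by linarith
    have hint := integrableOn_besselIntegrand t 0 hx0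
    have hre : (besselMoment t 0 x).re = ∫ v in Ioi (0 : ℝ), (besselIntegrand t 0 x v).re := by
      simpa [besselMoment] using (integral_re hint).symm
    have i1 : IntegrableOn ((Ioc (0 : ℝ) (δ / 2)).indicator
        fun _ ↦ 1 / 2 * Real.exp (-(x * c₁))) (Ioi 0) := by
      refine Integrable.integrableOn ?_
      exact (integrable_indicator_iff measurableSet_Ioc).2
        (integrableOn_const (by simp))
    have i2 := (integrableOn_cosh_pow_mul_exp 0 one_pos).const_mul (Real.exp (-((x - 1) * c₂)))
    have e1 : ∫ v in Ioi (0 : ℝ), (Ioc (0 : ℝ) (δ / 2)).indicator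
        (fun _ ↦ 1 / 2 * Real.exp (-(x * c₁))) v = δ / 2 * (1 / 2 * Real.exp (-(x * c₁))) := by
      rw [setIntegral_indicator measurableSet_Ioc, inter_eq_right.2 Ioc_subset_Ioi_self,
        setIntegral_const]
      simp only [measureReal_def, Real.volume_Ioc, sub_zero, smul_eq_mul]
      rw [ENNReal.toReal_ofReal (by positivity)]
    rw [hre, ← e1, hM, ← integral_const_mul, ← integral_sub i1 i2]
    refine setIntegral_mono_on (i1.sub i2) hint.re measurableSet_Ioi fun v hv ↦ ?_
    have hv0 : (0 : ℝ) < v := hv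
    have hval : (besselIntegrand t 0 x v).re =
        Real.exp (-(x * Real.cosh v)) * Real.cos (t * v) := by
      rw [besselIntegrand, cosh_I_mul, ← Complex.ofReal_mul, Complex.ofReal_re]; simp
    change _ ≤ (besselIntegrand t 0 x v).re
    rw [hval]
    simp only [pow_zero, one_mul]
    by_cases h2 : v ≤ δ
    · have htv : |t * v| ≤ 1 := by
        rw [abs_mul, abs_of_pos hv0]
        calc |t| * v ≤ (1 + |t|) * δ := by gcongr; linarith
          _ = 1 := by rw [hδ]; field_simp
      have hcos : 1 / 2 ≤ Real.cos (t * v) := by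
        have := @Real.one_sub_sq_div_two_le_cos (t * v)
        have h3 : (t * v) ^ 2 ≤ 1 := by rwa [sq_le_one_iff_abs_le_one]
        linarith
      have hp1 := Real.exp_pos (-((x - 1) * c₂))
      have hp2 := Real.exp_pos (-Real.cosh v)
      have hp3 := Real.exp_pos (-(x * Real.cosh v))
      by_cases h1 : v ≤ δ / 2
      · rw [indicator_of_mem (show v ∈ Ioc 0 (δ / 2) from ⟨hv0, h1⟩)]
        have : Real.cosh v ≤ c₁ := Real.cosh_le_cosh.2 (by
          rwa [abs_of_pos hv0, abs_of_pos (half_pos hδ0)])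
        have h4 : Real.exp (-(x * c₁)) ≤ Real.exp (-(x * Real.cosh v)) := by gcongr
        nlinarith [mul_pos hp1 hp2]
      · rw [indicator_of_notMem (fun h ↦ h1 h.2)]
        nlinarith [mul_pos hp1 hp2]
    · rw [indicator_of_notMem (fun h ↦ h2 (h.2.trans (by linarith)))]
      have hcv : c₂ ≤ Real.cosh v := Real.cosh_le_cosh.2 (by
        rw [abs_of_pos hv0, abs_of_pos hδ0]; linarith)
      have h5 : Real.exp (-(x * Real.cosh v)) ≤
          Real.exp (-((x - 1) * c₂)) * Real.exp (-Real.cosh v) := by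
        rw [← Real.exp_add]
        gcongr
        nlinarith
      have h6 := Real.neg_one_le_cos (t * v)
      nlinarith [Real.exp_pos (-(x * Real.cosh v))]
  -- This is the tail bound divided by `exp(-x c₁)`. It tends to zero because `c₁ < c₂`, so it falls
  -- below `δ/4`.
  have hlim : Tendsto (fun x : ℝ ↦ Real.exp (-(x * (c₂ - c₁))) * (Real.exp c₂ * M)) atTop
      (nhds 0) := by
    have : Tendsto (fun x : ℝ ↦ Real.exp (-(x * (c₂ - c₁)))) atTop (nhds 0) :=
      Real.tendsto_exp_atBot.comp (tendsto_neg_atTop_atBot.comp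
        (tendsto_id.atTop_mul_const (sub_pos.2 hc)))
    simpa using this.mul_const (Real.exp c₂ * M)
  obtain ⟨x, hx1, hx2⟩ := ((eventually_ge_atTop (1 : ℝ)).and
    (hlim.eventually_lt_const (show (0 : ℝ) < δ / 4 by positivity))).exists
  refine ⟨x, by linarith, fun h0 ↦ ?_⟩
  have h := hlow x hx1
  rw [h0, Complex.zero_re] at h
  have e2 : Real.exp (-((x - 1) * c₂)) * M =
      Real.exp (-(x * c₁)) * (Real.exp (-(x * (c₂ - c₁))) * (Real.exp c₂ * M)) := by
    rw [← mul_assoc, ← mul_assoc, ← Real.exp_add, ← Real.exp_add]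
    congr 2; ring
  rw [e2] at h
  nlinarith [Real.exp_pos (-(x * c₁)), mul_pos (Real.exp_pos (-(x * c₁))) (sub_pos.2 hx2)]

/-- The decaying solution `√y K_{it}(ay)` of `β'' = (a² - (1/4 + t²)/y²) β`. -/
noncomputable def besselSol (t a y : ℝ) : ℂ := (Real.sqrt y : ℂ) * besselMoment t 0 (a * y)

/-- The derivative of `besselSol`. -/
noncomputable def besselSolDeriv (t a y : ℝ) : ℂ :=
  ((1 / (2 * Real.sqrt y) : ℝ) : ℂ) * besselMoment t 0 (a * y) -
    (Real.sqrt y : ℂ) * a * besselMoment t 1 (a * y)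

lemma hasDerivAt_besselMoment_mul (t : ℝ) (j : ℕ) {a y : ℝ} (ha : 0 < a) (hy : 0 < y) :
    HasDerivAt (fun y ↦ besselMoment t j (a * y)) (-(a * besselMoment t (j + 1) (a * y))) y := by
  have h1 : HasDerivAt (fun y : ℝ ↦ a * y) a y := by simpa using (hasDerivAt_id y).const_mul a
  have := (hasDerivAt_besselMoment t j (mul_pos ha hy)).scomp y h1
  refine this.congr_deriv ?_
  rw [Complex.real_smul]; ring

lemma hasDerivAt_besselSol (t : ℝ) {a y : ℝ} (ha : 0 < a) (hy : 0 < y) :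
    HasDerivAt (besselSol t a) (besselSolDeriv t a y) y := by
  have := (Real.hasDerivAt_sqrt hy.ne').ofReal_comp.mul (hasDerivAt_besselMoment_mul t 0 ha hy)
  refine this.congr_deriv ?_
  rw [besselSolDeriv]; ring

lemma hasDerivAt_besselSolDeriv (t : ℝ) {a y : ℝ} (ha : 0 < a) (hy : 0 < y) :
    HasDerivAt (besselSolDeriv t a)
      (((a ^ 2 - (1 / 4 + t ^ 2) / y ^ 2 : ℝ) : ℂ) * besselSol t a y) y := by
  have hs : 0 < Real.sqrt y := Real.sqrt_pos.2 hy
  have h1 : HasDerivAt (fun y ↦ 1 / (2 * Real.sqrt y)) (-(1 / (4 * y * Real.sqrt y))) y := by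
    have h := ((Real.hasDerivAt_sqrt hy.ne').const_mul 2).inv (by positivity)
    simp only [one_div]
    refine h.congr_deriv ?_
    have hsq : Real.sqrt y ^ 2 = y := Real.sq_sqrt hy.le
    field_simp
    rw [hsq]; ring
  have h2 := (h1.ofReal_comp.mul (hasDerivAt_besselMoment_mul t 0 ha hy)).sub
    (((Real.hasDerivAt_sqrt hy.ne').ofReal_comp.mul_const (a : ℂ)).mul
      (hasDerivAt_besselMoment_mul t 1 ha hy))
  refine h2.congr_deriv ?_
  have hode := besselMoment_ode t (mul_pos ha hy)
  rw [besselSol]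
  -- With `y = s²` every square root becomes rational, and the claim is a multiple of the Bessel
  -- equation.
  obtain ⟨s, hs0, rfl⟩ : ∃ s : ℝ, 0 < s ∧ y = s ^ 2 := ⟨_, hs, (Real.sq_sqrt hy.le).symm⟩
  rw [Real.sqrt_sq hs0.le] at *
  have hsc : (s : ℂ) ≠ 0 := by exact_mod_cast hs0.ne'
  push_cast at hode ⊢
  field_simp
  linear_combination 8 * hode

/-- The derivative is bounded along with the solution because both enter the Wronskian. The factor
`y` covers both `√y` and `1/(2√y)`. -/
lemma exists_norm_besselSol_le (t : ℝ) {a : ℝ} (ha : 0 < a) :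
    ∃ C : ℝ, 0 ≤ C ∧ ∀ y : ℝ, 1 ≤ y → 1 ≤ a * y →
      ‖besselSol t a y‖ ≤ C * (y * Real.exp (-(a * y))) ∧
      ‖besselSolDeriv t a y‖ ≤ C * (y * Real.exp (-(a * y))) := by
  set M : ℕ → ℝ := fun j ↦ ∫ v in Ioi (0 : ℝ), Real.cosh v ^ j * Real.exp (-(1 * Real.cosh v))
  have hM : ∀ j, 0 ≤ M j := fun j ↦ integral_nonneg fun v ↦ by
    have := Real.cosh_pos v
    simp only [Pi.zero_apply]; positivity
  refine ⟨Real.exp 1 * (M 0 + a * M 1), by have := hM 0; have := hM 1; positivity,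
    fun y hy hay ↦ ?_⟩
  have h0 := hM 0
  have h1 := hM 1
  have e : Real.exp (-(a * y - 1)) = Real.exp 1 * Real.exp (-(a * y)) := by
    rw [← Real.exp_add]; congr 1; ring
  have b0 := norm_besselMoment_le t 0 hay
  have b1 := norm_besselMoment_le t 1 hay
  change _ ≤ _ * M 0 at b0
  change _ ≤ _ * M 1 at b1
  rw [e] at b0 b1
  have hsq1 : 1 ≤ Real.sqrt y := Real.one_le_sqrt.2 hy
  have hsq2 : Real.sqrt y ≤ y := by
    have := Real.sq_sqrt (zero_le_one.trans hy)
    nlinarith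
  have hinv : 1 / (2 * Real.sqrt y) ≤ y := by
    rw [div_le_iff₀ (by positivity)]; nlinarith
  have hE := Real.exp_pos (-(a * y))
  have hE1 := Real.exp_pos 1
  constructor
  · rw [besselSol, norm_mul, Complex.norm_real, Real.norm_of_nonneg (Real.sqrt_nonneg _)]
    calc Real.sqrt y * ‖besselMoment t 0 (a * y)‖
        ≤ y * (Real.exp 1 * Real.exp (-(a * y)) * (M 0 + a * M 1)) := by
          gcongr
          refine b0.trans ?_
          gcongr
          nlinarith
      _ = _ := by ring
  · rw [besselSolDeriv]
    refine (norm_sub_le _ _).trans ?_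
    rw [norm_mul, norm_mul, norm_mul, Complex.norm_real, Complex.norm_real, Complex.norm_real,
      Real.norm_of_nonneg (Real.sqrt_nonneg _), Real.norm_of_nonneg ha.le,
      Real.norm_of_nonneg (by positivity)]
    calc _ ≤ y * (Real.exp 1 * Real.exp (-(a * y)) * M 0) +
          y * a * (Real.exp 1 * Real.exp (-(a * y)) * M 1) := by gcongr
      _ = _ := by ring

end MaassRaised

/-! ### The twisted oscillatory integral: bounds and raising recurrence -/

namespace MaassRaised

open MeasureTheory Set Filter
open scoped FourierTransform

/-- The point `1/2 + it` of the critical line. -/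
noncomputable def critPoint (t : ℝ) : ℂ := 1 / 2 + Complex.I * t

/-- The function `(1 + v²)^{-s} ((v-i)/(v+i))^m (v-i)^{-j} (v+i)^{-l}` for `s = 1/2 + it`. -/
noncomputable def kernel (t : ℝ) (m j l : ℕ) (v : ℝ) : ℂ :=
  Complex.exp (-critPoint t * (Real.log (1 + v ^ 2) : ℝ)) * (v - Complex.I) ^ m *
    ((v + Complex.I)⁻¹) ^ m * ((v - Complex.I)⁻¹) ^ j * ((v + Complex.I)⁻¹) ^ l

lemma sub_I_ne_zero (v : ℝ) : (v : ℂ) - Complex.I ≠ 0 := fun h ↦ by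
  simpa using congrArg Complex.im h

lemma add_I_ne_zero (v : ℝ) : (v : ℂ) + Complex.I ≠ 0 := fun h ↦ by
  simpa using congrArg Complex.im h

lemma sub_I_mul_add_I (v : ℝ) : ((v : ℂ) - Complex.I) * (v + Complex.I) = 1 + (v : ℂ) ^ 2 := by
  linear_combination -Complex.I_sq

lemma norm_sub_I (v : ℝ) : ‖(v : ℂ) - Complex.I‖ = Real.sqrt (1 + v ^ 2) := by
  rw [Complex.norm_eq_sqrt_sq_add_sq]; congr 1; simp; ring

lemma norm_add_I (v : ℝ) : ‖(v : ℂ) + Complex.I‖ = Real.sqrt (1 + v ^ 2) := by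
  rw [Complex.norm_eq_sqrt_sq_add_sq]; congr 1; simp; ring

lemma norm_kernel (t : ℝ) (m j l : ℕ) (v : ℝ) :
    ‖kernel t m j l v‖ = (Real.sqrt (1 + v ^ 2))⁻¹ ^ (1 + j + l) := by
  have hpos : 0 < 1 + v ^ 2 := by positivity
  have hs : 0 < Real.sqrt (1 + v ^ 2) := Real.sqrt_pos.2 hpos
  have he : ‖Complex.exp (-critPoint t * (Real.log (1 + v ^ 2) : ℝ))‖ =
      (Real.sqrt (1 + v ^ 2))⁻¹ := by
    rw [Complex.norm_exp, ← Real.exp_log hs, ← Real.exp_neg, Real.log_sqrt hpos.le]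
    congr 1
    simp [critPoint]
    ring
  rw [kernel, norm_mul, norm_mul, norm_mul, norm_mul, he, norm_pow, norm_pow, norm_pow, norm_pow,
    norm_inv, norm_inv, norm_sub_I, norm_add_I, pow_add, pow_add, pow_one]
  rw [mul_assoc (Real.sqrt (1 + v ^ 2))⁻¹, ← mul_pow, mul_inv_cancel₀ hs.ne', one_pow, mul_one]

lemma contDiff_kernel (t : ℝ) (m j l : ℕ) : ContDiff ℝ ∞ (kernel t m j l) := by
  have hv : ContDiff ℝ ∞ (fun v : ℝ ↦ (v : ℂ)) := Complex.ofRealCLM.contDiff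
  have h1 : ContDiff ℝ ∞ (fun v : ℝ ↦ (v : ℂ) - Complex.I) := hv.sub contDiff_const
  have h2 : ContDiff ℝ ∞ (fun v : ℝ ↦ (v : ℂ) + Complex.I) := hv.add contDiff_const
  have h3 : ContDiff ℝ ∞ (fun v : ℝ ↦ ((v : ℂ) - Complex.I)⁻¹) := h1.inv sub_I_ne_zero
  have h4 : ContDiff ℝ ∞ (fun v : ℝ ↦ ((v : ℂ) + Complex.I)⁻¹) := h2.inv add_I_ne_zero
  have h5 : ContDiff ℝ ∞ (fun v : ℝ ↦ ((Real.log (1 + v ^ 2) : ℝ) : ℂ)) := by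
    refine Complex.ofRealCLM.contDiff.comp (ContDiff.log ?_ fun v ↦ by positivity)
    fun_prop
  exact ((((contDiff_const.mul h5).cexp.mul (h1.pow m)).mul (h4.pow m)).mul (h3.pow j)).mul
    (h4.pow l)

/-- Formally the kernel is `(v-i)^{-(s-m+j)} (v+i)^{-(s+m+l)}`, and the two terms come from lowering
one exponent or the other. The indices `j` and `l` make the family closed under differentiation. -/
lemma hasDerivAt_kernel (t : ℝ) (m j l : ℕ) (v : ℝ) :
    HasDerivAt (kernel t m j l) (-(critPoint t - m + j) * kernel t m (j + 1) l v +
      -(critPoint t + m + l) * kernel t m j (l + 1) v) v := by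
  have hv : HasDerivAt (fun v : ℝ ↦ (v : ℂ)) 1 v := Complex.ofRealCLM.hasDerivAt
  have h1 := hv.sub_const Complex.I
  have h2 := hv.add_const Complex.I
  have h3 := h1.fun_inv (sub_I_ne_zero v)
  have h4 := h2.fun_inv (add_I_ne_zero v)
  have h5 : HasDerivAt (fun v : ℝ ↦ ((Real.log (1 + v ^ 2) : ℝ) : ℂ))
      ((2 * v / (1 + v ^ 2) : ℝ) : ℂ) v := by
    have h : HasDerivAt (fun v : ℝ ↦ 1 + v ^ 2) (2 * v) v := by
      simpa using (hasDerivAt_pow 2 v).const_add 1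
    exact (h.log (by positivity)).ofReal_comp
  have key := ((((h5.const_mul (-critPoint t)).cexp.mul (h1.fun_pow m)).mul (h4.fun_pow m)).mul
    (h3.fun_pow j)).mul (h4.fun_pow l)
  refine key.congr_deriv ?_
  simp only [kernel, Pi.mul_apply]
  -- Rewrites the truncated exponent `n - 1` in a form that is also valid for `n = 0`.
  have hpow : ∀ (n : ℕ) (w : ℂ), w ≠ 0 → (n : ℂ) * w ^ (n - 1) = n * w ^ n * w⁻¹ := by
    intro n w hw
    rcases n with _ | n
    · simp
    · rw [Nat.add_sub_cancel, pow_succ]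
      field_simp
  have hA := sub_I_ne_zero v
  have hB := add_I_ne_zero v
  rw [hpow m _ hA, hpow m _ (inv_ne_zero hB), hpow j _ (inv_ne_zero hA), hpow l _ (inv_ne_zero hB)]
  have hC : ((2 * v / (1 + v ^ 2) : ℝ) : ℂ) =
      ((v : ℂ) - Complex.I)⁻¹ + ((v : ℂ) + Complex.I)⁻¹ := by
    push_cast
    rw [← sub_I_mul_add_I]
    field_simp
    ring
  rw [hC]
  generalize Complex.exp (-critPoint t * (Real.log (1 + v ^ 2) : ℝ)) = E
  simp only [pow_succ (M := ℂ), pow_zero, one_mul, div_eq_mul_inv, mul_inv, inv_inv]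
  field_simp
  ring

lemma deriv_kernel (t : ℝ) (m j l : ℕ) :
    deriv (kernel t m j l) = fun v ↦ -(critPoint t - m + j) * kernel t m (j + 1) l v +
      -(critPoint t + m + l) * kernel t m j (l + 1) v :=
  funext fun v ↦ (hasDerivAt_kernel t m j l v).deriv

lemma norm_critPoint_le (t : ℝ) : ‖critPoint t‖ ≤ 1 / 2 + |t| := by
  refine (norm_add_le _ _).trans ?_
  simp

/-- Each derivative yields two terms whose coefficients are at most the sum of the parameters, and
each raises the order of decay by one. -/
lemma norm_iteratedDeriv_kernel_le (t : ℝ) (m N : ℕ) : ∀ (j l : ℕ) (v : ℝ),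
    ‖iteratedDeriv N (kernel t m j l) v‖ ≤
      (2 * (1 / 2 + |t| + m + j + l + N)) ^ N *
        (Real.sqrt (1 + v ^ 2))⁻¹ ^ (1 + j + l + N) := by
  induction N with
  | zero => intro j l v; simp [norm_kernel]
  | succ N ih =>
    intro j l v
    have c1 : ContDiffAt ℝ N (kernel t m (j + 1) l) v :=
      ((contDiff_kernel t m (j + 1) l).of_le (by exact_mod_cast le_top)).contDiffAt
    have c2 : ContDiffAt ℝ N (kernel t m j (l + 1)) v :=
      ((contDiff_kernel t m j (l + 1)).of_le (by exact_mod_cast le_top)).contDiffAt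
    rw [iteratedDeriv_succ', deriv_kernel,
      iteratedDeriv_fun_add (contDiffAt_const.mul c1) (contDiffAt_const.mul c2),
      iteratedDeriv_const_mul _ c1, iteratedDeriv_const_mul _ c2]
    have h1 := ih (j + 1) l v
    have h2 := ih j (l + 1) v
    -- Raising `j` or `l` by one makes up for lowering `N` by one, so the base of the power is
    -- unchanged along the induction.
    have e1 : (2 * (1 / 2 + |t| + m + ((j + 1 : ℕ) : ℝ) + l + N)) =
      2 * (1 / 2 + |t| + m + j + l + (N + 1 : ℕ)) := by push_cast; ring
    have e2 : (2 * (1 / 2 + |t| + m + j + ((l + 1 : ℕ) : ℝ) + N)) =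
      2 * (1 / 2 + |t| + m + j + l + (N + 1 : ℕ)) := by push_cast; ring
    have e3 : 1 + (j + 1) + l + N = 1 + j + l + (N + 1) := by ring
    have e4 : 1 + j + (l + 1) + N = 1 + j + l + (N + 1) := by ring
    rw [e1, e3] at h1
    rw [e2, e4] at h2
    set B := 1 / 2 + |t| + m + j + l + (N + 1 : ℕ) with hB
    set r := (Real.sqrt (1 + v ^ 2))⁻¹ ^ (1 + j + l + (N + 1))
    have hs := norm_critPoint_le t
    have a1 : ‖-(critPoint t - m + j)‖ ≤ B := by
      rw [norm_neg]
      refine (norm_add_le _ _).trans ((add_le_add_left (norm_sub_le _ _) _).trans ?_)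
      simp only [Complex.norm_natCast]
      rw [hB]; push_cast
      have : (0 : ℝ) ≤ l := l.cast_nonneg
      have : (0 : ℝ) ≤ N := N.cast_nonneg
      linarith
    have a2 : ‖-(critPoint t + m + l)‖ ≤ B := by
      rw [norm_neg]
      refine (norm_add_le _ _).trans ((add_le_add_left (norm_add_le _ _) _).trans ?_)
      simp only [Complex.norm_natCast]
      rw [hB]; push_cast
      have : (0 : ℝ) ≤ j := j.cast_nonneg
      have : (0 : ℝ) ≤ N := N.cast_nonneg
      linarith
    have hB0 : 0 ≤ B := (norm_nonneg _).trans a1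
    refine (norm_add_le _ _).trans ?_
    rw [norm_mul, norm_mul]
    calc _ ≤ B * ((2 * B) ^ N * r) + B * ((2 * B) ^ N * r) := by gcongr
      _ = _ := by ring

lemma continuous_iteratedDeriv_kernel (t : ℝ) (m j l N : ℕ) :
    Continuous (iteratedDeriv N (kernel t m j l)) :=
  (contDiff_kernel t m j l).continuous_iteratedDeriv N (by exact_mod_cast le_top)

lemma hasDerivAt_iteratedDeriv_kernel (t : ℝ) (m N : ℕ) (v : ℝ) :
    HasDerivAt (iteratedDeriv N (kernel t m 0 0)) (iteratedDeriv (N + 1) (kernel t m 0 0) v) v := by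
  rw [iteratedDeriv_succ]
  exact ((contDiff_kernel t m 0 0).differentiable_iteratedDeriv N
    (by exact_mod_cast ENat.natCast_lt_top N) v).hasDerivAt

lemma inv_sqrt_pow_le (v : ℝ) {N : ℕ} (hN : 2 ≤ N) :
    (Real.sqrt (1 + v ^ 2))⁻¹ ^ N ≤ (1 + v ^ 2)⁻¹ := by
  have h1 : (Real.sqrt (1 + v ^ 2))⁻¹ ≤ 1 := inv_le_one_of_one_le₀ (Real.one_le_sqrt.2 (by nlinarith))
  refine (pow_le_pow_of_le_one (by positivity) h1 hN).trans ?_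
  rw [inv_pow, Real.sq_sqrt (by positivity)]

lemma norm_iteratedDeriv_kernel_le_inv (t : ℝ) (m : ℕ) {N : ℕ} (hN : 1 ≤ N) (v : ℝ) :
    ‖iteratedDeriv N (kernel t m 0 0) v‖ ≤
      (2 * (1 / 2 + |t| + m + N)) ^ N * (1 + v ^ 2)⁻¹ := by
  have h := norm_iteratedDeriv_kernel_le t m N 0 0 v
  simp only [Nat.cast_zero, add_zero] at h
  exact h.trans (mul_le_mul_of_nonneg_left (inv_sqrt_pow_le v (by omega)) (by positivity))

lemma integrable_iteratedDeriv_kernel (t : ℝ) (m : ℕ) {N : ℕ} (hN : 1 ≤ N) :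
    Integrable (iteratedDeriv N (kernel t m 0 0)) :=
  Integrable.mono' (integrable_inv_one_add_sq.const_mul _)
    (continuous_iteratedDeriv_kernel t m 0 0 N).aestronglyMeasurable
    (Eventually.of_forall fun v ↦ norm_iteratedDeriv_kernel_le_inv t m hN v)

/-- The `N`-th derivative decays like `|v|^{-1-N}`, so two derivatives are needed to afford a factor
`v`. -/
lemma integrable_mul_iteratedDeriv_kernel (t : ℝ) (m : ℕ) {N : ℕ} (hN : 2 ≤ N) :
    Integrable (fun v : ℝ ↦ (v : ℂ) * iteratedDeriv N (kernel t m 0 0) v) := by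
  refine Integrable.mono' (integrable_inv_one_add_sq.const_mul
    ((2 * (1 / 2 + |t| + m + N)) ^ N))
    (Complex.continuous_ofReal.mul
      (continuous_iteratedDeriv_kernel t m 0 0 N)).aestronglyMeasurable
    (Eventually.of_forall fun v ↦ ?_)
  have h := norm_iteratedDeriv_kernel_le t m N 0 0 v
  simp only [Nat.cast_zero, add_zero] at h
  have hs : 0 < Real.sqrt (1 + v ^ 2) := Real.sqrt_pos.2 (by positivity)
  have hv : |v| ≤ Real.sqrt (1 + v ^ 2) := Real.abs_le_sqrt (by linarith)
  rw [norm_mul, Complex.norm_real, Real.norm_eq_abs]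
  calc |v| * ‖iteratedDeriv N (kernel t m 0 0) v‖
      ≤ Real.sqrt (1 + v ^ 2) * ((2 * (1 / 2 + |t| + m + N)) ^ N *
          (Real.sqrt (1 + v ^ 2))⁻¹ ^ (1 + N)) := by gcongr
    _ = (2 * (1 / 2 + |t| + m + N)) ^ N * (Real.sqrt (1 + v ^ 2))⁻¹ ^ N := by
        rw [pow_add, pow_one]; field_simp
    _ ≤ _ := mul_le_mul_of_nonneg_left (inv_sqrt_pow_le v hN) (by positivity)

/-- The conditionally convergent integral `∫ (1 + v²)^{-s} ((v-i)/(v+i))^m e(-Yv) dv`, defined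
through integration by parts. -/
noncomputable def oscIntegral (t : ℝ) (m : ℕ) (Y : ℝ) : ℂ :=
  𝓕 (deriv (kernel t m 0 0)) Y / (2 * Real.pi * Complex.I * Y)

lemma two_pi_I_mul_ne_zero {Y : ℝ} (hY : Y ≠ 0) : 2 * (Real.pi : ℂ) * Complex.I * Y ≠ 0 := by
  simp [hY, Real.pi_ne_zero]

/-- The case `N = 0` is excluded because the kernel itself, of size `1/|v|`, is not integrable. -/
lemma fourier_iteratedDeriv_kernel_succ (t : ℝ) (m : ℕ) {N : ℕ} (hN : 1 ≤ N) (Y : ℝ) :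
    𝓕 (iteratedDeriv (N + 1) (kernel t m 0 0)) Y =
      2 * Real.pi * Complex.I * Y * 𝓕 (iteratedDeriv N (kernel t m 0 0)) Y := by
  have h := Real.fourier_deriv (integrable_iteratedDeriv_kernel t m hN)
    (fun v ↦ (hasDerivAt_iteratedDeriv_kernel t m N v).differentiableAt)
    (by rw [← iteratedDeriv_succ]; exact integrable_iteratedDeriv_kernel t m (by omega))
  rw [iteratedDeriv_succ, h]
  rfl

lemma oscIntegral_eq (t : ℝ) (m : ℕ) {N : ℕ} (hN : 1 ≤ N) {Y : ℝ} (hY : Y ≠ 0) :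
    oscIntegral t m Y =
      𝓕 (iteratedDeriv N (kernel t m 0 0)) Y / (2 * Real.pi * Complex.I * Y) ^ N := by
  induction N, hN using Nat.le_induction with
  | base => rw [pow_one, iteratedDeriv_one, oscIntegral]
  | succ N hN ih =>
    rw [ih, fourier_iteratedDeriv_kernel_succ t m hN, pow_succ',
      mul_div_mul_left _ _ (two_pi_I_mul_ne_zero hY)]

lemma norm_phase (Y v : ℝ) : ‖Complex.exp (((-2 * Real.pi * v * Y : ℝ) : ℂ) * Complex.I)‖ = 1 :=
  Complex.norm_exp_ofReal_mul_I _

lemma norm_two_pi_I_mul (Y : ℝ) : ‖2 * (Real.pi : ℂ) * Complex.I * Y‖ = 2 * Real.pi * |Y| := by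
  simp [abs_of_pos Real.pi_pos]

lemma norm_oscIntegral_le (t : ℝ) (m : ℕ) {N : ℕ} (hN : 1 ≤ N) {Y : ℝ} (hY : Y ≠ 0) :
    ‖oscIntegral t m Y‖ ≤ Real.pi * ((1 / 2 + |t| + m + N) / |Y|) ^ N := by
  have hY' : 0 < |Y| := abs_pos.2 hY
  have h1 : ‖𝓕 (iteratedDeriv N (kernel t m 0 0)) Y‖ ≤
      (2 * (1 / 2 + |t| + m + N)) ^ N * Real.pi := by
    have e : ∫ v : ℝ, (2 * (1 / 2 + |t| + m + N)) ^ N * (1 + v ^ 2)⁻¹ =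
        (2 * (1 / 2 + |t| + m + N)) ^ N * Real.pi := by
      rw [integral_const_mul, integral_univ_inv_one_add_sq]
    rw [Real.fourier_real_eq_integral_exp_smul, ← e]
    refine norm_integral_le_of_norm_le (integrable_inv_one_add_sq.const_mul _)
      (Eventually.of_forall fun v ↦ ?_)
    rw [norm_smul, norm_phase, one_mul]
    exact norm_iteratedDeriv_kernel_le_inv t m hN v
  rw [oscIntegral_eq t m hN hY, norm_div, norm_pow, norm_two_pi_I_mul, div_le_iff₀ (by positivity)]
  refine h1.trans ?_
  have hpi : (1 : ℝ) ≤ Real.pi := by linarith [Real.pi_gt_three]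
  have h2 : (1 : ℝ) ≤ Real.pi ^ N := one_le_pow₀ hpi
  have e : Real.pi * ((1 / 2 + |t| + m + N) / |Y|) ^ N * (2 * Real.pi * |Y|) ^ N =
      (2 * (1 / 2 + |t| + m + N)) ^ N * Real.pi * Real.pi ^ N := by
    rw [div_pow, mul_pow, mul_pow, mul_pow]; field_simp
  rw [e]
  exact le_mul_of_one_le_right (by positivity) h2

lemma norm_integral_Ioi_le {f : ℝ → ℂ} {C T : ℝ} (hT : 0 < T)
    (hf : ∀ v, ‖f v‖ ≤ C * (1 + v ^ 2)⁻¹) : ‖∫ v in Ioi T, f v‖ ≤ C / T := by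
  have hC : 0 ≤ C := by simpa using (norm_nonneg _).trans (hf 0)
  have hi := (integrableOn_Ioi_rpow_of_lt (show (-2 : ℝ) < -1 by norm_num) hT).const_mul C
  calc ‖∫ v in Ioi T, f v‖ ≤ ∫ v in Ioi T, C * v ^ (-2 : ℝ) := by
        refine norm_integral_le_of_norm_le hi ?_
        refine (ae_restrict_iff' measurableSet_Ioi).2 (Eventually.of_forall fun v hv ↦ ?_)
        have hv0 : 0 < v := hT.trans hv
        refine (hf v).trans ?_
        rw [Real.rpow_neg hv0.le]
        gcongr
        norm_num
    _ = C / T := by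
        rw [integral_const_mul, integral_Ioi_rpow_of_lt (by norm_num) hT]
        norm_num
        rw [Real.rpow_neg hT.le, Real.rpow_one, div_eq_mul_inv]

/-- Oscillation is used only for `|v| > T`, in the form of one integration by parts. On `|v| ≤ T`
the kernel is integrated in absolute value, and `(1+v²)^{-1/2}` has primitive `arsinh`. -/
lemma norm_oscIntegral_le_arsinh (t : ℝ) (m : ℕ) {Y : ℝ} (hY : Y ≠ 0) :
    ‖oscIntegral t m Y‖ ≤ 2 * Real.arsinh ((3 / 2 + |t| + m) / |Y|) + 1 := by
  have hY' : 0 < |Y| := abs_pos.2 hY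
  set B := 3 / 2 + |t| + m with hB
  have hB1 : 1 ≤ B := by
    have : (0 : ℝ) ≤ m := m.cast_nonneg
    have := abs_nonneg t
    rw [hB]; linarith
  -- This cut balances the tails of size `B/T` against the factor `|Y|` in the definition of
  -- `oscIntegral`.
  set T := B / |Y| with hT
  have hT0 : 0 < T := by positivity
  set G := kernel t m 0 0 with hG
  have hGd : ∀ v, HasDerivAt G (iteratedDeriv 1 G v) v := fun v ↦ by
    simpa using hasDerivAt_iteratedDeriv_kernel t m 0 v
  set e : ℝ → ℂ := fun v ↦ Complex.exp (((-2 * Real.pi * v * Y : ℝ) : ℂ) * Complex.I) with he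
  have hed : ∀ v, HasDerivAt e (-(2 * Real.pi * Complex.I * Y) * e v) v := by
    intro v
    have h1 : HasDerivAt (fun v : ℝ ↦ -2 * Real.pi * v * Y) (-2 * Real.pi * Y) v := by
      simpa using ((hasDerivAt_id v).const_mul (-2 * Real.pi)).mul_const Y
    refine (h1.ofReal_comp.mul_const Complex.I).cexp.congr_deriv ?_
    rw [he]; push_cast; ring
  have hec : Continuous e := continuous_iff_continuousAt.2 fun v ↦ (hed v).continuousAt
  have hen : ∀ v, ‖e v‖ = 1 := fun v ↦ norm_phase Y v
  have hG1c : Continuous (iteratedDeriv 1 G) := continuous_iteratedDeriv_kernel t m 0 0 1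
  have hGc : Continuous G := (contDiff_kernel t m 0 0).continuous
  have hbd : ∀ v, ‖e v * iteratedDeriv 1 G v‖ ≤ 2 * B * (1 + v ^ 2)⁻¹ := by
    intro v
    rw [norm_mul, hen, one_mul]
    refine (norm_iteratedDeriv_kernel_le_inv t m le_rfl v).trans (le_of_eq ?_)
    rw [hB]; push_cast; ring
  have hint : Integrable (fun v ↦ e v * iteratedDeriv 1 G v) :=
    Integrable.mono' (integrable_inv_one_add_sq.const_mul _)
      (hec.mul hG1c).aestronglyMeasurable (Eventually.of_forall hbd)
  have hsplit : 𝓕 (iteratedDeriv 1 G) Y = (∫ v in Iic (-T), e v * iteratedDeriv 1 G v) +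
      ((∫ v in (-T)..T, e v * iteratedDeriv 1 G v) +
        ∫ v in Ioi T, e v * iteratedDeriv 1 G v) := by
    rw [Real.fourier_real_eq_integral_exp_smul,
      intervalIntegral.integral_interval_add_Ioi hint.integrableOn hint.integrableOn,
      intervalIntegral.integral_Iic_add_Ioi hint.integrableOn hint.integrableOn]
    rfl
  -- The integration by parts is undone on the bounded range, where the kernel itself is integrable.
  have hparts : (∫ v in (-T)..T, e v * iteratedDeriv 1 G v) =
      e T * G T - e (-T) * G (-T) +
        2 * Real.pi * Complex.I * Y * ∫ v in (-T)..T, e v * G v := by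
    rw [intervalIntegral.integral_mul_deriv_eq_deriv_mul (fun v _ ↦ hed v) (fun v _ ↦ hGd v)
      ((continuous_const.mul hec).intervalIntegrable _ _) (hG1c.intervalIntegrable _ _),
      ← intervalIntegral.integral_const_mul, sub_eq_add_neg, ← intervalIntegral.integral_neg]
    congr 1
    refine intervalIntegral.integral_congr fun v _ ↦ ?_
    ring
  have htail1 := norm_integral_Ioi_le hT0 hbd
  have htail2 : ‖∫ v in Iic (-T), e v * iteratedDeriv 1 G v‖ ≤ 2 * B / T := by
    rw [← integral_comp_neg_Ioi T (fun v ↦ e v * iteratedDeriv 1 G v)]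
    refine norm_integral_Ioi_le hT0 fun v ↦ ?_
    simpa using hbd (-v)
  have hGn : ∀ v, ‖G v‖ = (Real.sqrt (1 + v ^ 2))⁻¹ := fun v ↦ by
    rw [hG, norm_kernel]; simp
  have hsT : T ≤ Real.sqrt (1 + T ^ 2) := Real.le_sqrt_of_sq_le (by linarith)
  have hbdy1 : ‖e T * G T‖ ≤ 1 / T := by
    rw [norm_mul, hen, one_mul, hGn, one_div]
    gcongr
  have hbdy2 : ‖e (-T) * G (-T)‖ ≤ 1 / T := by
    rw [norm_mul, hen, one_mul, hGn, one_div, neg_sq]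
    gcongr
  have hmid : ‖∫ v in (-T)..T, e v * G v‖ ≤ 2 * Real.arsinh T := by
    have hc : Continuous fun v : ℝ ↦ (Real.sqrt (1 + v ^ 2))⁻¹ :=
      Continuous.inv₀ (by fun_prop) fun v ↦ (Real.sqrt_pos.2 (by positivity)).ne'
    have h := intervalIntegral.norm_integral_le_of_norm_le (a := -T) (b := T) (μ := volume)
      (f := fun v ↦ e v * G v) (g := fun v ↦ (Real.sqrt (1 + v ^ 2))⁻¹) (by linarith)
      (Eventually.of_forall fun v _ ↦ by rw [norm_mul, hen, one_mul, hGn])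
      (hc.intervalIntegrable _ _)
    refine h.trans (le_of_eq ?_)
    rw [intervalIntegral.integral_eq_sub_of_hasDerivAt (fun v _ ↦ Real.hasDerivAt_arsinh v)
      (hc.intervalIntegrable _ _), Real.arsinh_neg]
    ring
  have hnum : ‖𝓕 (iteratedDeriv 1 G) Y‖ ≤
      6 * B / T + 2 * Real.pi * |Y| * (2 * Real.arsinh T) := by
    rw [hsplit, hparts]
    have h1 : 1 / T ≤ B / T := by gcongr
    calc _ ≤ 2 * B / T + ((1 / T + 1 / T + 2 * Real.pi * |Y| * (2 * Real.arsinh T)) +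
          2 * B / T) := by
          refine (norm_add_le _ _).trans (add_le_add htail2 ((norm_add_le _ _).trans
            (add_le_add ((norm_add_le _ _).trans (add_le_add ((norm_sub_le _ _).trans
            (add_le_add hbdy1 hbdy2)) ?_)) htail1)))
          rw [norm_mul, norm_two_pi_I_mul]
          gcongr
      _ ≤ _ := by
          have e1 : 6 * B / T = 2 * B / T + 2 * B / T + B / T + B / T := by ring
          linarith
  -- After division by `2π|Y|` this contributes `3/π < 1`, the summand `1` of the bound.
  have hBT : 6 * B / T = 6 * |Y| := by
    rw [hT]; field_simp
  rw [oscIntegral_eq t m le_rfl hY, pow_one, norm_div, norm_two_pi_I_mul,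
    div_le_iff₀ (by positivity)]
  refine hnum.trans ?_
  rw [hBT]
  nlinarith [Real.pi_gt_three]

lemma arsinh_le_rpow {T ε : ℝ} (hT : 0 ≤ T) (hε : 0 < ε) :
    Real.arsinh T ≤ (1 + 2 * T) ^ ε / ε := by
  have h1 : T + Real.sqrt (1 + T ^ 2) ≤ 1 + 2 * T := by
    have : Real.sqrt (1 + T ^ 2) ≤ 1 + T := Real.sqrt_le_iff.2 ⟨by linarith, by nlinarith⟩
    linarith
  have h2 : 0 < T + Real.sqrt (1 + T ^ 2) := by
    have : 0 < Real.sqrt (1 + T ^ 2) := Real.sqrt_pos.2 (by positivity)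
    linarith
  exact (Real.log_le_log h2 h1).trans (Real.log_le_rpow_div (by linarith) hε)

/-- The raising recurrence at the level of kernels. -/
lemma kernel_succ (t : ℝ) (m : ℕ) (v : ℝ) :
    (critPoint t + m) * kernel t (m + 1) 0 0 v =
      (m - critPoint t) * kernel t m 0 0 v - (v - Complex.I) *
        iteratedDeriv 1 (kernel t m 0 0) v := by
  rw [iteratedDeriv_one, deriv_kernel]
  have hA := sub_I_ne_zero v
  have hB := add_I_ne_zero v
  simp only [kernel, pow_succ (M := ℂ), pow_zero, one_mul, mul_one, zero_add, Nat.cast_zero,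
    add_zero]
  generalize Complex.exp (-critPoint t * (Real.log (1 + v ^ 2) : ℝ)) = E
  field_simp
  ring

/-- `kernel_succ` differentiated twice. The factor `v - i` contributes `-1` each time, which turns
`m - s` into `m - 2 - s`. -/
lemma iteratedDeriv_two_kernel_succ (t : ℝ) (m : ℕ) (v : ℝ) :
    (critPoint t + m) * iteratedDeriv 2 (kernel t (m + 1) 0 0) v =
      (m - 2 - critPoint t) * iteratedDeriv 2 (kernel t m 0 0) v - (v - Complex.I) *
        iteratedDeriv 3 (kernel t m 0 0) v := by
  have hv : ∀ v : ℝ, HasDerivAt (fun v : ℝ ↦ (v : ℂ) - Complex.I) 1 v := fun v ↦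
    Complex.ofRealCLM.hasDerivAt.sub_const _
  have d : ∀ (n N : ℕ) (v : ℝ), HasDerivAt (iteratedDeriv N (kernel t n 0 0))
      (iteratedDeriv (N + 1) (kernel t n 0 0) v) v := fun n N v ↦
    hasDerivAt_iteratedDeriv_kernel t n N v
  have d0 : ∀ (n : ℕ) (v : ℝ), HasDerivAt (kernel t n 0 0)
      (iteratedDeriv 1 (kernel t n 0 0) v) v := fun n v ↦ by simpa using d n 0 v
  have step1 : ∀ v : ℝ, (critPoint t + m) * iteratedDeriv 1 (kernel t (m + 1) 0 0) v =
      (m - 1 - critPoint t) * iteratedDeriv 1 (kernel t m 0 0) v - (v - Complex.I) *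
        iteratedDeriv 2 (kernel t m 0 0) v := by
    intro v
    have h1 := (d0 (m + 1) v).const_mul (critPoint t + m)
    rw [show (fun v ↦ (critPoint t + m) * kernel t (m + 1) 0 0 v) = _ from
      funext (kernel_succ t m)] at h1
    have h2 := ((d0 m v).const_mul ((m : ℂ) - critPoint t)).sub ((hv v).mul (d m 1 v))
    rw [h1.unique h2]
    ring
  have h1 := (d (m + 1) 1 v).const_mul (critPoint t + m)
  rw [show (fun v ↦ (critPoint t + m) * iteratedDeriv 1 (kernel t (m + 1) 0 0) v) = _ from
    funext step1] at h1
  have h2 := ((d m 1 v).const_mul ((m : ℂ) - 1 - critPoint t)).sub ((hv v).mul (d m 2 v))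
  rw [h1.unique h2]
  ring

lemma fourier_eq_integral_mul (f : ℝ → ℂ) (Y : ℝ) :
    𝓕 f Y = ∫ v : ℝ, Complex.exp (((-2 * Real.pi * v * Y : ℝ) : ℂ) * Complex.I) * f v := by
  rw [Real.fourier_real_eq_integral_exp_smul]; rfl

lemma integrable_phase_mul {f : ℝ → ℂ} (hf : Integrable f) (Y : ℝ) :
    Integrable fun v : ℝ ↦ Complex.exp (((-2 * Real.pi * v * Y : ℝ) : ℂ) * Complex.I) * f v := by
  refine hf.bdd_mul (c := 1) ?_ (Eventually.of_forall fun v ↦ (norm_phase Y v).le)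
  exact (Continuous.aestronglyMeasurable (by fun_prop))

/-- The Fourier transform of `kernel_succ`: multiplication by `v` becomes `d/dY`, and
differentiation becomes multiplication by `2πiY`. Everything is done at the level of second
derivatives, where the required integrals converge absolutely. -/
lemma hasDerivAt_oscIntegral (t : ℝ) (m : ℕ) {Y : ℝ} (hY : Y ≠ 0) :
    HasDerivAt (oscIntegral t m) (((critPoint t + m) * oscIntegral t (m + 1) Y -
      (m + 1 - critPoint t - 2 * Real.pi * Y) * oscIntegral t m Y) / Y) Y := by
  set G2 := iteratedDeriv 2 (kernel t m 0 0) with hG2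
  set G3 := iteratedDeriv 3 (kernel t m 0 0) with hG3
  have i2 : Integrable G2 := integrable_iteratedDeriv_kernel t m (by norm_num)
  have i3 : Integrable G3 := integrable_iteratedDeriv_kernel t m (by norm_num)
  have iv2 : Integrable (fun v : ℝ ↦ (v : ℂ) * G2 v) :=
    integrable_mul_iteratedDeriv_kernel t m le_rfl
  have iv3 : Integrable (fun v : ℝ ↦ (v : ℂ) * G3 v) :=
    integrable_mul_iteratedDeriv_kernel t m (by norm_num)
  have hYc : (Y : ℂ) ≠ 0 := by exact_mod_cast hY
  have hpi := two_pi_I_mul_ne_zero hY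
  have hd : ∀ v : ℝ, HasDerivAt (fun v : ℝ ↦ (v : ℂ) * G2 v) (G2 v + v * G3 v) v := by
    intro v
    have := (Complex.ofRealCLM.hasDerivAt (x := v)).mul
      (hasDerivAt_iteratedDeriv_kernel t m 2 v)
    refine this.congr_deriv ?_
    rw [Complex.ofRealCLM_apply, Complex.ofRealCLM_apply, Complex.ofReal_one, one_mul]
  have hderiv : deriv (fun v : ℝ ↦ (v : ℂ) * G2 v) = fun v : ℝ ↦ G2 v + v * G3 v :=
    funext fun v ↦ (hd v).deriv
  have hF := Real.hasDerivAt_fourier i2 (by simpa only [Complex.real_smul] using iv2) Y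
  have hF1 : 𝓕 (fun v : ℝ ↦ (-2 * (Real.pi : ℂ) * Complex.I * v) • G2 v) Y =
      -(2 * Real.pi * Complex.I) * 𝓕 (fun v : ℝ ↦ (v : ℂ) * G2 v) Y := by
    rw [fourier_eq_integral_mul, fourier_eq_integral_mul, ← integral_const_mul]
    congr 1; ext v
    rw [smul_eq_mul]; ring
  have hF2 : 𝓕 (fun v : ℝ ↦ G2 v + v * G3 v) Y =
      2 * Real.pi * Complex.I * Y * 𝓕 (fun v : ℝ ↦ (v : ℂ) * G2 v) Y := by
    have := Real.fourier_deriv iv2 (fun v ↦ (hd v).differentiableAt)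
      (by rw [hderiv]; exact i2.add iv3)
    rw [← hderiv, this]
    rfl
  have hF3 : 𝓕 G3 Y = 2 * Real.pi * Complex.I * Y * 𝓕 G2 Y :=
    fourier_iteratedDeriv_kernel_succ t m (by norm_num) Y
  have hF4 : (critPoint t + m) * 𝓕 (iteratedDeriv 2 (kernel t (m + 1) 0 0)) Y =
      (m - 1 - critPoint t) * 𝓕 G2 Y - 𝓕 (fun v : ℝ ↦ G2 v + v * G3 v) Y +
        Complex.I * 𝓕 G3 Y := by
    simp only [fourier_eq_integral_mul]
    have j2 := integrable_phase_mul i2 Y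
    have j3 := integrable_phase_mul i3 Y
    have j4 := integrable_phase_mul (i2.add iv3) Y
    simp only [Pi.add_apply] at j4
    rw [← integral_const_mul, ← integral_const_mul, ← integral_const_mul,
      ← integral_sub (j2.const_mul _) j4]
    refine Eq.trans ?_ (integral_add ((j2.const_mul _).sub j4) (j3.const_mul _))
    congr 1; ext v
    rw [mul_left_comm, iteratedDeriv_two_kernel_succ]
    ring
  have hloc : oscIntegral t m =ᶠ[nhds Y]
      fun Y ↦ 𝓕 G2 Y * ((2 * Real.pi * Complex.I * Y) ^ 2)⁻¹ := by
    filter_upwards [isOpen_ne.mem_nhds hY] with Y' hY'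
    rw [oscIntegral_eq t m (N := 2) (by norm_num) hY', div_eq_mul_inv]
  have hp : HasDerivAt (fun Y : ℝ ↦ (((2 * (Real.pi : ℂ) * Complex.I * Y) ^ 2)⁻¹ : ℂ))
      (-2 * ((2 * Real.pi * Complex.I * Y) ^ 2)⁻¹ / Y) Y := by
    have h1 : HasDerivAt (fun Y : ℝ ↦ 2 * (Real.pi : ℂ) * Complex.I * Y)
        (2 * Real.pi * Complex.I) Y := by
      simpa using (Complex.ofRealCLM.hasDerivAt (x := Y)).const_mul
        (2 * (Real.pi : ℂ) * Complex.I)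
    refine ((h1.fun_pow 2).fun_inv (pow_ne_zero 2 hpi)).congr_deriv ?_
    have hpi' : (Real.pi : ℂ) ≠ 0 := by exact_mod_cast Real.pi_ne_zero
    have := Complex.I_ne_zero
    field_simp
    push_cast
    ring
  refine ((hF.mul hp).congr_of_eventuallyEq hloc).congr_deriv ?_
  rw [hF1, oscIntegral_eq t m (N := 2) (by norm_num) hY,
    oscIntegral_eq t (m + 1) (N := 2) (by norm_num) hY]
  rw [hF2, hF3] at hF4
  rw [eq_div_iff hYc, add_mul, mul_assoc (𝓕 G2 Y), div_mul_cancel₀ _ hYc, ← hG2,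
    div_eq_mul_inv, div_eq_mul_inv]
  generalize ((2 * (Real.pi : ℂ) * Complex.I * Y) ^ 2)⁻¹ = D
  linear_combination (-D) * hF4 - 2 * Real.pi * Y * 𝓕 G2 Y * D * Complex.I_sq

end MaassRaised

/-! ### Evaluation of the untwisted integral as a Bessel function -/

namespace MaassRaised

open MeasureTheory Set Filter
open scoped FourierTransform

lemma critPoint_re (t : ℝ) : (critPoint t).re = 1 / 2 := by simp [critPoint]

lemma critPoint_add_one_re (t : ℝ) : (critPoint t + 1).re = 3 / 2 := by
  rw [Complex.add_re, critPoint_re, Complex.one_re]; norm_num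

lemma critPoint_ne_zero (t : ℝ) : critPoint t ≠ 0 := fun h ↦ by
  have := critPoint_re t
  rw [h] at this
  norm_num at this

lemma integrableOn_rpow_mul_exp_neg_mul {a r : ℝ} (ha : 0 < a) (hr : 0 < r) :
    IntegrableOn (fun u : ℝ ↦ u ^ (a - 1) * Real.exp (-(r * u))) (Ioi 0) := by
  have := integrableOn_rpow_mul_exp_neg_mul_rpow (p := 1) (s := a - 1) (b := r) (by linarith)
    one_pos hr
  simpa only [Real.rpow_one, neg_mul] using this

/-- The integrand of the double integral evaluating `Γ(s) ∫ G'(v) e(-Yv) dv`. -/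
noncomputable def gammaKernel (t Y v u : ℝ) : ℂ :=
  Complex.exp (((-2 * Real.pi * v * Y : ℝ) : ℂ) * Complex.I) * (-2 * v) *
    ((u : ℂ) ^ critPoint t * Complex.exp (-(((1 + v ^ 2 : ℝ) : ℂ) * u)))

lemma norm_gammaKernel (t Y v : ℝ) {u : ℝ} (hu : 0 < u) :
    ‖gammaKernel t Y v u‖ = 2 * |v| * (u ^ ((3 / 2 : ℝ) - 1) * Real.exp (-((1 + v ^ 2) * u))) := by
  rw [gammaKernel, norm_mul, norm_mul, norm_mul, norm_phase, one_mul, norm_mul,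
    Complex.norm_cpow_eq_rpow_re_of_pos hu, critPoint_re, Complex.norm_real,
    Complex.norm_exp, Real.norm_eq_abs]
  congr 2
  · simp
  · norm_num
  · rw [← Complex.ofReal_mul, ← Complex.ofReal_neg, Complex.ofReal_re]

lemma measurable_gammaKernel (t Y : ℝ) : Measurable fun p : ℝ × ℝ ↦ gammaKernel t Y p.1 p.2 := by
  unfold gammaKernel
  fun_prop

lemma integrable_gammaKernel_right (t Y v : ℝ) :
    IntegrableOn (gammaKernel t Y v) (Ioi 0) := by
  have h := (integrableOn_rpow_mul_exp_neg_mul (a := 3 / 2) (by norm_num)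
    (show 0 < 1 + v ^ 2 by positivity)).const_mul (2 * |v|)
  refine Integrable.mono' h
    ((measurable_gammaKernel t Y).comp measurable_prodMk_left).aestronglyMeasurable ?_
  exact (ae_restrict_iff' measurableSet_Ioi).2
    (Eventually.of_forall fun u hu ↦ (norm_gammaKernel t Y v hu).le)

lemma integral_norm_gammaKernel (t Y v : ℝ) :
    ∫ u in Ioi (0 : ℝ), ‖gammaKernel t Y v u‖ =
      2 * |v| * ((1 / (1 + v ^ 2)) ^ (3 / 2 : ℝ) * Real.Gamma (3 / 2)) := by
  rw [← Real.integral_rpow_mul_exp_neg_mul_Ioi (by norm_num) (show 0 < 1 + v ^ 2 by positivity),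
    ← integral_const_mul]
  exact setIntegral_congr_fun measurableSet_Ioi fun u hu ↦ norm_gammaKernel t Y v hu

/-- The differentiated kernel makes Fubini legitimate: the integral over `u` of the absolute value
is a multiple of `|v| (1+v²)^{-3/2}`, which is integrable. -/
lemma integrable_gammaKernel (t Y : ℝ) :
    Integrable (Function.uncurry (gammaKernel t Y)) (volume.prod (volume.restrict (Ioi 0))) := by
  refine (integrable_prod_iff (measurable_gammaKernel t Y).aestronglyMeasurable).2
    ⟨Eventually.of_forall fun v ↦ integrable_gammaKernel_right t Y v, ?_⟩
  refine Integrable.mono' (integrable_inv_one_add_sq.const_mul (2 * Real.Gamma (3 / 2))) ?_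
    (Eventually.of_forall fun v ↦ ?_)
  · exact ((measurable_gammaKernel t Y).norm.stronglyMeasurable.integral_prod_right
      (ν := volume.restrict (Ioi 0))).aestronglyMeasurable
  · have hG : 0 < Real.Gamma (3 / 2) := Real.Gamma_pos_of_pos (by norm_num)
    have hp : 0 < 1 + v ^ 2 := by positivity
    simp only
    rw [integral_norm_gammaKernel, Real.norm_of_nonneg (by positivity)]
    have hv : |v| ≤ Real.sqrt (1 + v ^ 2) := Real.abs_le_sqrt (by linarith)
    have e : (1 / (1 + v ^ 2)) ^ (3 / 2 : ℝ) = (1 + v ^ 2)⁻¹ * (Real.sqrt (1 + v ^ 2))⁻¹ := by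
      rw [one_div, show (3 / 2 : ℝ) = 1 + 1 / 2 by norm_num,
        Real.rpow_add (inv_pos.2 hp), Real.rpow_one, ← Real.sqrt_eq_rpow, Real.sqrt_inv]
    have hs : 0 < Real.sqrt (1 + v ^ 2) := Real.sqrt_pos.2 hp
    rw [e]
    calc 2 * |v| * ((1 + v ^ 2)⁻¹ * (Real.sqrt (1 + v ^ 2))⁻¹ * Real.Gamma (3 / 2))
        ≤ 2 * Real.sqrt (1 + v ^ 2) *
          ((1 + v ^ 2)⁻¹ * (Real.sqrt (1 + v ^ 2))⁻¹ * Real.Gamma (3 / 2)) := by gcongr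
      _ = _ := by field_simp

/-- For `m = 0` the derivative of the kernel is `-2sv (1+v²)^{-s-1}`. The Gamma integral at `s + 1`
produces it, with `Γ(s+1) = sΓ(s)` absorbing the factor `s`. -/
lemma integral_gammaKernel_right (t Y v : ℝ) :
    ∫ u in Ioi (0 : ℝ), gammaKernel t Y v u =
      Complex.exp (((-2 * Real.pi * v * Y : ℝ) : ℂ) * Complex.I) *
        (Complex.Gamma (critPoint t) * deriv (kernel t 0 0 0) v) := by
  have hp : 0 < 1 + v ^ 2 := by positivity
  have h := Complex.integral_cpow_mul_exp_neg_mul_Ioi (a := critPoint t + 1) (r := 1 + v ^ 2)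
    (by rw [critPoint_add_one_re]; norm_num) hp
  rw [add_sub_cancel_right, Complex.Gamma_add_one _ (critPoint_ne_zero t)] at h
  simp only [gammaKernel]
  rw [integral_const_mul, h, deriv_kernel]
  have hpc : ((1 + v ^ 2 : ℝ) : ℂ) ≠ 0 := by exact_mod_cast hp.ne'
  have e : (1 / ((1 + v ^ 2 : ℝ) : ℂ)) ^ (critPoint t + 1) =
      Complex.exp (-critPoint t * (Real.log (1 + v ^ 2) : ℝ)) * ((1 + v ^ 2 : ℝ) : ℂ)⁻¹ := by
    rw [one_div, ← Complex.ofReal_inv, Complex.cpow_add _ _ (by exact_mod_cast (inv_pos.2 hp).ne'),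
      Complex.cpow_one, Complex.cpow_def_of_ne_zero (by exact_mod_cast (inv_pos.2 hp).ne'),
      ← Complex.ofReal_log (inv_pos.2 hp).le, Real.log_inv]
    congr 2
    push_cast
    ring
  rw [e]
  simp only [kernel, pow_zero, pow_one, mul_one, Nat.cast_zero, sub_zero, add_zero, zero_add]
  generalize Complex.exp (-critPoint t * (Real.log (1 + v ^ 2) : ℝ)) = E
  have hA := sub_I_ne_zero v
  have hB := add_I_ne_zero v
  have hC : ((1 + v ^ 2 : ℝ) : ℂ) = ((v : ℂ) - Complex.I) * (v + Complex.I) := by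
    rw [sub_I_mul_add_I]; push_cast; ring
  rw [hC]
  field_simp
  ring

/-- Up to the factor `u`, the integrand contains the derivative of a Gaussian, so its transform is
`2πiY` times a Gaussian. -/
lemma integral_phase_mul_gaussian_deriv (Y : ℝ) {u : ℝ} (hu : 0 < u) :
    ∫ v : ℝ, Complex.exp (((-2 * Real.pi * v * Y : ℝ) : ℂ) * Complex.I) *
      ((-2 * v) * Complex.exp (-(u : ℂ) * v ^ 2)) =
    2 * Real.pi * Complex.I * Y * ((Real.sqrt Real.pi : ℝ) : ℂ) *
      (((u ^ (-(3 / 2) : ℝ) * Real.exp (-(Real.pi * Y) ^ 2 / u) : ℝ)) : ℂ) := by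
  have hu' : 0 < (u : ℂ).re := by simpa using hu
  have hd : ∀ v : ℝ, HasDerivAt (fun v : ℝ ↦ Complex.exp (-(u : ℂ) * v ^ 2))
      (u * ((-2 * v) * Complex.exp (-(u : ℂ) * v ^ 2))) v := by
    intro v
    have h := (((Complex.ofRealCLM.hasDerivAt (x := v)).fun_pow 2).const_mul (-(u : ℂ))).cexp
    refine h.congr_deriv ?_
    simp only [Complex.ofRealCLM_apply, Complex.ofReal_one]
    push_cast
    ring
  have hderiv : deriv (fun v : ℝ ↦ Complex.exp (-(u : ℂ) * v ^ 2)) =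
      fun v : ℝ ↦ u * ((-2 * v) * Complex.exp (-(u : ℂ) * v ^ 2)) :=
    funext fun v ↦ (hd v).deriv
  have hint : Integrable fun v : ℝ ↦ (u : ℂ) * ((-2 * v) * Complex.exp (-(u : ℂ) * v ^ 2)) := by
    have := (integrable_mul_cexp_neg_mul_sq hu').const_mul (-2 * (u : ℂ))
    refine this.congr (Eventually.of_forall fun v ↦ ?_)
    ring
  have h1 := congrFun (Real.fourier_deriv (integrable_cexp_neg_mul_sq hu')
    (fun v ↦ (hd v).differentiableAt) (by rw [hderiv]; exact hint)) Y
  rw [hderiv, fourier_eq_integral_mul] at h1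
  have h2 := fourier_gaussian_innerProductSpace (V := ℝ) hu' Y
  have h3 : 𝓕 (fun v : ℝ ↦ Complex.exp (-(u : ℂ) * v ^ 2)) Y =
      (((Real.pi / u) ^ (1 / 2 : ℝ) * Real.exp (-(Real.pi * Y) ^ 2 / u) : ℝ) : ℂ) := by
    have e : (fun v : ℝ ↦ Complex.exp (-(u : ℂ) * v ^ 2)) =
        fun v : ℝ ↦ Complex.exp (-(u : ℂ) * (‖v‖ : ℝ) ^ 2) := by
      funext v
      rw [Real.norm_eq_abs, ← Complex.ofReal_pow, ← Complex.ofReal_pow, sq_abs]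
    rw [e, h2, Real.norm_eq_abs, ← Complex.ofReal_pow |Y|, sq_abs, Module.finrank_self,
      Complex.ofReal_mul, Complex.ofReal_cpow (by positivity)]
    push_cast
    congr 2
    ring
  have hu0 : (u : ℂ) ≠ 0 := by exact_mod_cast hu.ne'
  have h4 : ∫ v : ℝ, Complex.exp (((-2 * Real.pi * v * Y : ℝ) : ℂ) * Complex.I) *
      (u * ((-2 * v) * Complex.exp (-(u : ℂ) * v ^ 2))) =
      u * ∫ v : ℝ, Complex.exp (((-2 * Real.pi * v * Y : ℝ) : ℂ) * Complex.I) *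
      ((-2 * v) * Complex.exp (-(u : ℂ) * v ^ 2)) := by
    rw [← integral_const_mul]
    congr 1; ext v; ring
  rw [h4, h3, smul_eq_mul] at h1
  refine mul_left_cancel₀ hu0 (h1.trans ?_)
  have e5 : (Real.pi / u) ^ (1 / 2 : ℝ) = u * (Real.sqrt Real.pi * u ^ (-(3 / 2) : ℝ)) := by
    rw [Real.div_rpow Real.pi_pos.le hu.le, Real.sqrt_eq_rpow,
      show (-(3 / 2) : ℝ) = -1 + -(1 / 2) by norm_num, Real.rpow_add hu, Real.rpow_neg hu.le,
      Real.rpow_neg hu.le, Real.rpow_one]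
    field_simp
  rw [e5]
  push_cast
  ring

lemma integral_gammaKernel_left (t Y : ℝ) {u : ℝ} (hu : 0 < u) :
    ∫ v : ℝ, gammaKernel t Y v u =
      2 * Real.pi * Complex.I * Y * ((Real.sqrt Real.pi : ℝ) : ℂ) *
        ((u : ℂ) ^ (Complex.I * t - 1) * ((Real.exp (-u - (Real.pi * Y) ^ 2 / u) : ℝ) : ℂ)) := by
  have hu0 : (u : ℂ) ≠ 0 := by exact_mod_cast hu.ne'
  have e : ∀ v : ℝ, gammaKernel t Y v u = (u : ℂ) ^ critPoint t * Complex.exp (-u) *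
      (Complex.exp (((-2 * Real.pi * v * Y : ℝ) : ℂ) * Complex.I) *
        ((-2 * v) * Complex.exp (-(u : ℂ) * v ^ 2))) := by
    intro v
    have : Complex.exp (-(((1 + v ^ 2 : ℝ) : ℂ) * u)) =
        Complex.exp (-u) * Complex.exp (-(u : ℂ) * v ^ 2) := by
      rw [← Complex.exp_add]; congr 1; push_cast; ring
    rw [gammaKernel, this]
    ring
  simp_rw [e]
  rw [integral_const_mul, integral_phase_mul_gaussian_deriv Y hu]
  have e1 : (u : ℂ) ^ (Complex.I * t - 1) = (u : ℂ) ^ critPoint t * ((u ^ (-(3 / 2) : ℝ) : ℝ) : ℂ) := by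
    rw [Complex.ofReal_cpow hu.le, ← Complex.cpow_add _ _ hu0]
    congr 1
    rw [critPoint]
    push_cast
    ring
  have e2 : Real.exp (-u - (Real.pi * Y) ^ 2 / u) =
      Real.exp (-u) * Real.exp (-(Real.pi * Y) ^ 2 / u) := by
    rw [← Real.exp_add]; congr 1; ring
  rw [e1, e2]
  push_cast
  ring

lemma Gamma_mul_fourier_kernel (t Y : ℝ) :
    Complex.Gamma (critPoint t) * 𝓕 (deriv (kernel t 0 0 0)) Y =
      2 * Real.pi * Complex.I * Y * ((Real.sqrt Real.pi : ℝ) : ℂ) *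
        ∫ u in Ioi (0 : ℝ), (u : ℂ) ^ (Complex.I * t - 1) *
          ((Real.exp (-u - (Real.pi * Y) ^ 2 / u) : ℝ) : ℂ) := by
  rw [fourier_eq_integral_mul, ← integral_const_mul, ← integral_const_mul]
  have h := integral_integral_swap (integrable_gammaKernel t Y)
  simp_rw [integral_gammaKernel_right] at h
  calc _ = _ := by congr 1; ext v; ring
    _ = _ := h
    _ = _ := setIntegral_congr_fun measurableSet_Ioi fun u hu ↦ integral_gammaKernel_left t Y hu

lemma one_add_sq_le_two_mul_cosh (w : ℝ) : 1 + w ^ 2 ≤ 2 * Real.cosh w := by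
  have h1 : Real.cosh w = 1 + 2 * Real.sinh (w / 2) ^ 2 := by
    have := Real.cosh_two_mul (w / 2)
    rw [Real.cosh_sq, mul_div_cancel₀ _ (two_ne_zero)] at this
    linarith
  have h2 : (w / 2) ^ 2 ≤ Real.sinh (w / 2) ^ 2 := by
    rw [sq_le_sq, Real.abs_sinh]
    exact Real.self_le_sinh_iff.2 (abs_nonneg _)
  nlinarith

lemma integrable_exp_neg_cosh {x : ℝ} (hx : 0 < x) :
    Integrable fun w : ℝ ↦ Real.exp (-(x * Real.cosh w)) := by
  refine Integrable.mono' (integrable_inv_one_add_sq.const_mul (2 / x))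
    (Continuous.aestronglyMeasurable (by fun_prop)) (Eventually.of_forall fun w ↦ ?_)
  have hc := Real.cosh_pos w
  have h1 : Real.exp (-(x * Real.cosh w)) ≤ (x * Real.cosh w)⁻¹ := by
    rw [Real.exp_neg]
    have := Real.add_one_le_exp (x * Real.cosh w)
    gcongr
    linarith
  have h2 : (2 * Real.cosh w)⁻¹ ≤ (1 + w ^ 2)⁻¹ :=
    inv_anti₀ (by positivity) (one_add_sq_le_two_mul_cosh w)
  rw [Real.norm_of_nonneg (Real.exp_pos _).le]
  calc _ ≤ _ := h1
    _ = 2 / x * (2 * Real.cosh w)⁻¹ := by field_simp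
    _ ≤ _ := by gcongr

lemma integral_comp_const_mul_exp {c : ℝ} (hc : 0 < c) (g : ℝ → ℂ) :
    ∫ u in Ioi (0 : ℝ), g u = ∫ w : ℝ, ((c * Real.exp w : ℝ) : ℂ) * g (c * Real.exp w) := by
  have himg : (fun w : ℝ ↦ c * Real.exp w) '' univ = Ioi 0 := by
    ext u
    simp only [image_univ, mem_range, mem_Ioi]
    constructor
    · rintro ⟨w, rfl⟩
      positivity
    · intro hu
      exact ⟨Real.log (u / c), by rw [Real.exp_log (by positivity)]; field_simp⟩
  rw [← himg, integral_image_eq_integral_abs_deriv_smul MeasurableSet.univ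
    (fun w _ ↦ ((Real.hasDerivAt_exp w).const_mul c).hasDerivWithinAt)
    (fun a _ b _ hab ↦ Real.exp_injective (mul_left_cancel₀ hc.ne' hab)), setIntegral_univ]
  congr 1; ext w
  rw [abs_of_pos (by positivity), Complex.real_smul]

lemma integral_exp_mul_cosh (t : ℝ) {x : ℝ} (hx : 0 < x) :
    ∫ w : ℝ, Complex.exp (Complex.I * t * w) * ((Real.exp (-(x * Real.cosh w)) : ℝ) : ℂ) =
      2 * besselMoment t 0 x := by
  set h : ℝ → ℂ := fun w ↦
    Complex.exp (Complex.I * t * w) * ((Real.exp (-(x * Real.cosh w)) : ℝ) : ℂ) with hh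
  have hint : Integrable h := by
    have he : Integrable fun w : ℝ ↦ ((Real.exp (-(x * Real.cosh w)) : ℝ) : ℂ) :=
      (integrable_exp_neg_cosh hx).ofReal
    refine he.bdd_mul (c := 1) (Continuous.aestronglyMeasurable (by fun_prop))
      (Eventually.of_forall fun w ↦ ?_)
    rw [Complex.norm_exp]
    simp
  rw [← intervalIntegral.integral_Iic_add_Ioi (b := 0) hint.integrableOn hint.integrableOn]
  have e1 : ∫ w in Iic (0 : ℝ), h w = ∫ w in Ioi (0 : ℝ), h (-w) := by
    rw [integral_comp_neg_Ioi, neg_zero]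
  rw [e1, ← integral_add hint.comp_neg.integrableOn hint.integrableOn, besselMoment,
    ← integral_const_mul]
  congr 1; ext w
  rw [hh, besselIntegrand, Complex.cosh]
  simp only [Real.cosh_neg, pow_zero, one_mul]
  push_cast
  rw [mul_neg]
  ring

/-- The evaluation of the oscillatory integral without twist in terms of the Bessel function. -/
lemma Gamma_mul_oscIntegral_zero (t : ℝ) {Y : ℝ} (hY : Y ≠ 0) :
    Complex.Gamma (critPoint t) * oscIntegral t 0 Y =
      2 * ((Real.sqrt Real.pi : ℝ) : ℂ) * ((Real.pi * |Y| : ℝ) : ℂ) ^ (Complex.I * t) *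
        besselMoment t 0 (2 * Real.pi * |Y|) := by
  have hY' : 0 < |Y| := abs_pos.2 hY
  have hc : 0 < Real.pi * |Y| := by positivity
  rw [oscIntegral, mul_div_assoc', Gamma_mul_fourier_kernel, mul_assoc (2 * _ * Complex.I * (Y : ℂ)),
    mul_div_cancel_left₀ _ (two_pi_I_mul_ne_zero hY), integral_comp_const_mul_exp hc]
  -- The substitution `u = π|Y| e^w` symmetrises the exponent: `u + (πY)²/u = 2π|Y| cosh w`.
  have e : ∀ w : ℝ, ((Real.pi * |Y| * Real.exp w : ℝ) : ℂ) *
      (((Real.pi * |Y| * Real.exp w : ℝ) : ℂ) ^ (Complex.I * t - 1) *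
        ((Real.exp (-(Real.pi * |Y| * Real.exp w) - (Real.pi * Y) ^ 2 /
          (Real.pi * |Y| * Real.exp w)) : ℝ) : ℂ)) =
      ((Real.pi * |Y| : ℝ) : ℂ) ^ (Complex.I * t) * (Complex.exp (Complex.I * t * w) *
        ((Real.exp (-(2 * Real.pi * |Y| * Real.cosh w)) : ℝ) : ℂ)) := by
    intro w
    have hu : 0 < Real.pi * |Y| * Real.exp w := by positivity
    have hu0 : ((Real.pi * |Y| * Real.exp w : ℝ) : ℂ) ≠ 0 := by exact_mod_cast hu.ne'
    have e1 : -(Real.pi * |Y| * Real.exp w) - (Real.pi * Y) ^ 2 / (Real.pi * |Y| * Real.exp w) =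
        -(2 * Real.pi * |Y| * Real.cosh w) := by
      rw [mul_pow, ← sq_abs Y, Real.cosh_eq, Real.exp_neg]
      field_simp
      ring
    rw [e1, Complex.cpow_sub _ _ hu0, Complex.cpow_one, ← mul_assoc, mul_div_cancel₀ _ hu0,
      ← mul_assoc]
    congr 1
    rw [Complex.ofReal_mul, Complex.mul_cpow_ofReal_nonneg hc.le (Real.exp_pos w).le]
    congr 1
    rw [Complex.cpow_def_of_ne_zero (by exact_mod_cast (Real.exp_pos w).ne'),
      ← Complex.ofReal_log (Real.exp_pos w).le, Real.log_exp]
    congr 1; ring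
  simp_rw [e]
  rw [integral_const_mul, integral_exp_mul_cosh t (by positivity)]
  ring

lemma norm_Gamma_critPoint_le (t : ℝ) : ‖Complex.Gamma (critPoint t)‖ ≤ Real.sqrt Real.pi := by
  have hs : 0 < (critPoint t).re := by rw [critPoint_re]; norm_num
  rw [← Real.Gamma_one_half_eq, Complex.Gamma_eq_integral hs, Real.Gamma_eq_integral (by norm_num),
    Complex.GammaIntegral]
  refine norm_integral_le_of_norm_le (Real.GammaIntegral_convergent (by norm_num)) ?_
  refine (ae_restrict_iff' measurableSet_Ioi).2 (Eventually.of_forall fun u hu ↦ ?_)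
  rw [norm_mul, Complex.norm_cpow_eq_rpow_re_of_pos hu, Complex.norm_real,
    Real.norm_of_nonneg (Real.exp_pos _).le, Complex.sub_re, critPoint_re, Complex.one_re]

end MaassRaised

/-! ### Growth of the coefficients and uniqueness of the decaying solution -/

namespace MaassRaised

open MeasureTheory Set Filter
open scoped ENNReal

lemma IsSmooth.continuous {f : ℍ → ℂ} (hf : IsSmooth f) : Continuous f := by
  have h : ContinuousOn (f ∘ ofComplex) {z : ℂ | 0 < z.im} := hf.continuousOn
  have := h.comp_continuous UpperHalfPlane.continuous_coe fun z ↦ z.im_pos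
  refine this.congr fun z ↦ ?_
  simp

/-- The rectangle `-1/2 < re z ≤ 1/2`, `Y < im z ≤ Y + 1`. -/
def cuspRect (Y : ℝ) : Set ℂ :=
  Complex.measurableEquivRealProd ⁻¹' (Ioc (-(1 / 2)) (1 / 2) ×ˢ Ioc Y (Y + 1))

lemma measurableSet_cuspRect (Y : ℝ) : MeasurableSet (cuspRect Y) :=
  Complex.measurableEquivRealProd.measurable (measurableSet_Ioc.prod measurableSet_Ioc)

lemma mem_cuspRect {Y : ℝ} {z : ℂ} :
    z ∈ cuspRect Y ↔ z.re ∈ Ioc (-(1 / 2) : ℝ) (1 / 2) ∧ z.im ∈ Ioc Y (Y + 1) := by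
  simp [cuspRect, Complex.measurableEquivRealProd_apply]

lemma coe_mem_cuspRect_mem_fd {Y : ℝ} (hY : 1 ≤ Y) {z : ℍ} (hz : (z : ℂ) ∈ cuspRect Y) :
    z ∈ ModularGroup.fd := by
  rw [mem_cuspRect] at hz
  obtain ⟨⟨h1, h2⟩, h3, -⟩ := hz
  refine ⟨?_, ?_⟩
  · rw [Complex.normSq_apply]
    nlinarith
  · rw [abs_le]
    exact ⟨h1.le, h2⟩

/-- For `Y ≥ 1` the rectangle lies in the fundamental domain, and the hyperbolic density `1/y²` is
at least `(Y+1)^{-2}` on it. -/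
lemma lintegral_cuspRect_le {f : ℍ → ℝ≥0∞} (hf : Measurable f) {Y : ℝ} (hY : 1 ≤ Y) :
    ∫⁻ w in cuspRect Y, f (ofComplex w) ≤
      ENNReal.ofReal ((Y + 1) ^ 2) * ∫⁻ z in ModularGroup.fd, f z := by
  have hmp : MeasurePreserving UpperHalfPlane.coe (volume.comap UpperHalfPlane.coe)
      (volume.restrict (range UpperHalfPlane.coe)) :=
    ⟨measurable_coe, by rw [measurableEmbedding_coe.map_comap]⟩
  set S : Set ℍ := UpperHalfPlane.coe ⁻¹' cuspRect Y with hS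
  have hSm : MeasurableSet S := measurable_coe (measurableSet_cuspRect Y)
  have hrange : cuspRect Y ⊆ range UpperHalfPlane.coe := by
    intro w hw
    have hw' : 0 < w.im := by linarith [(mem_cuspRect.1 hw).2.1]
    exact ⟨⟨w, hw'⟩, rfl⟩
  have e1 : ∫⁻ w in cuspRect Y, f (ofComplex w) =
      ∫⁻ z in S, f z ∂(volume.comap UpperHalfPlane.coe) := by
    have h := hmp.setLIntegral_comp_preimage_emb measurableEmbedding_coe
      (fun w ↦ f (ofComplex w)) (cuspRect Y)
    rw [Measure.restrict_restrict (measurableSet_cuspRect Y),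
      inter_eq_left.2 hrange] at h
    rw [← h]
    simp only [UpperHalfPlane.ofComplex_apply]
    rfl
  set d : ℍ → ℝ≥0∞ := fun z ↦ ((1 / NNReal.mk z.im z.im_pos.le) ^ 2 : NNReal) with hd
  have hdeq : d = fun z ↦ ENNReal.ofReal ((1 / z.im) ^ 2) := by
    funext z
    have h0 := z.im_pos
    rw [hd]
    simp only
    rw [ENNReal.ofReal, ENNReal.coe_inj]
    ext
    rw [Real.coe_toNNReal _ (by positivity)]
    rfl
  have hdm : Measurable d := by
    rw [hdeq]
    exact ((measurable_const.div UpperHalfPlane.continuous_im.measurable).pow_const 2).ennreal_ofReal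
  have e2 : ∫⁻ z in S, f z = ∫⁻ z in S, (d * f) z ∂(volume.comap UpperHalfPlane.coe) := by
    rw [UpperHalfPlane.volume_def]
    exact setLIntegral_withDensity_eq_setLIntegral_mul _ hdm hf hSm
  calc ∫⁻ w in cuspRect Y, f (ofComplex w)
      = ∫⁻ z in S, f z ∂(volume.comap UpperHalfPlane.coe) := e1
    _ ≤ ∫⁻ z in S, ENNReal.ofReal ((Y + 1) ^ 2) * (d * f) z
        ∂(volume.comap UpperHalfPlane.coe) := by
        refine setLIntegral_mono (measurable_const.mul (hdm.mul hf)) fun z hz ↦ ?_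
        have hz2 : z.im ≤ Y + 1 := (mem_cuspRect.1 hz).2.2
        have hone : 1 ≤ ENNReal.ofReal ((Y + 1) ^ 2) * d z := by
          have h0 := z.im_pos
          rw [hdeq, ← ENNReal.ofReal_mul (by positivity), ← ENNReal.ofReal_one]
          refine ENNReal.ofReal_le_ofReal ?_
          rw [← mul_pow]
          refine one_le_pow₀ ?_
          rw [mul_one_div, le_div_iff₀ h0]
          linarith
        rw [Pi.mul_apply, ← mul_assoc]
        exact le_mul_of_one_le_left zero_le hone
    _ = ENNReal.ofReal ((Y + 1) ^ 2) * ∫⁻ z in S, f z := by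
        rw [lintegral_const_mul _ (hdm.mul hf), e2]
    _ ≤ _ := by
        gcongr
        exact fun z hz ↦ coe_mem_cuspRect_mem_fd hY hz

lemma lintegral_cuspRect_eq {f : ℍ → ℝ≥0∞} (hf : Measurable f) (Y : ℝ) :
    ∫⁻ w in cuspRect Y, f (ofComplex w) =
      ∫⁻ y in Ioc Y (Y + 1), ∫⁻ x in Ioc (-(1 / 2) : ℝ) (1 / 2),
        f (ofComplex ((x : ℂ) + (y : ℂ) * Complex.I)) := by
  have hm : Measurable fun p : ℝ × ℝ ↦ f (ofComplex ((p.1 : ℂ) + (p.2 : ℂ) * Complex.I)) := by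
    have h1 : Measurable fun w : ℂ ↦ f (ofComplex w) := by
      refine hf.comp (measurableEmbedding_coe.measurable_comp_iff.1 ?_)
      -- `ofComplex` is the identity on the upper half-plane and constant elsewhere, hence
      -- measurable.
      have : UpperHalfPlane.coe ∘ ofComplex = fun w : ℂ ↦
          if 0 < w.im then w else ((ofComplex 0 : ℍ) : ℂ) := by
        funext w
        by_cases hw : 0 < w.im
        · simp only [Function.comp_apply, hw, if_true]
          exact coe_ofComplex_of_im_pos hw
        · simp only [Function.comp_apply, hw, if_false]
          rw [ofComplex_apply_eq_of_im_nonpos (not_lt.1 hw) (w' := 0) (by simp)]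
      rw [this]
      exact Measurable.ite (measurableSet_lt measurable_const Complex.measurable_im)
        measurable_id measurable_const
    exact h1.comp (by fun_prop)
  rw [← setLIntegral_prod_symm (fun p : ℝ × ℝ ↦ f (ofComplex ((p.1 : ℂ) + (p.2 : ℂ) * Complex.I)))
    hm.aemeasurable]
  have := Complex.volume_preserving_equiv_real_prod.setLIntegral_comp_preimage_emb
    Complex.measurableEquivRealProd.measurableEmbedding
    (fun p : ℝ × ℝ ↦ f (ofComplex ((p.1 : ℂ) + (p.2 : ℂ) * Complex.I)))
    (Ioc (-(1 / 2)) (1 / 2) ×ˢ Ioc Y (Y + 1))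
  rw [Measure.volume_eq_prod] at this
  rw [← this]
  simp only [Complex.measurableEquivRealProd_apply, Complex.re_add_im]
  rfl

/-- The elementary bound `a ≤ 1 + a²` replaces Cauchy-Schwarz. The period is shifted to `(-1/2,
1/2]` to fit the fundamental domain. -/
lemma norm_fourierCoeffAt_le {u : ℍ → ℂ} (hp : IsPeriodic u) (n : ℤ) {y : ℝ} (hy : 0 < y) :
    ‖fourierCoeffAt u n y‖ₑ ≤ 1 + ∫⁻ x in Ioc (-(1 / 2) : ℝ) (1 / 2),
      ‖u (ofComplex ((x : ℂ) + (y : ℂ) * Complex.I))‖ₑ ^ 2 := by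
  have hper : Function.Periodic (fun x : ℝ ↦
      u (ofComplex ((x : ℂ) + (y : ℂ) * Complex.I)) * negChar n x) 1 := by
    intro x
    simp only
    rw [negChar_add_one, ← hp ((x : ℂ) + (y : ℂ) * Complex.I) (by rwa [add_mul_I_im])]
    congr 3
    push_cast; ring
  have h := hper.intervalIntegral_add_eq 0 (-(1 / 2))
  rw [zero_add, show (-(1 / 2) + 1 : ℝ) = 1 / 2 by norm_num] at h
  rw [fourierCoeffAt_eq, h, intervalIntegral.integral_of_le (by norm_num)]
  refine (enorm_integral_le_lintegral_enorm _).trans ?_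
  calc ∫⁻ x in Ioc (-(1 / 2) : ℝ) (1 / 2),
        ‖u (ofComplex ((x : ℂ) + (y : ℂ) * Complex.I)) * negChar n x‖ₑ
      ≤ ∫⁻ x in Ioc (-(1 / 2) : ℝ) (1 / 2),
        (1 + ‖u (ofComplex ((x : ℂ) + (y : ℂ) * Complex.I))‖ₑ ^ 2) := by
        refine lintegral_mono fun x ↦ ?_
        have h1 : ‖negChar n x‖ₑ = 1 := by
          rw [← ofReal_norm, norm_negChar, ENNReal.ofReal_one]
        rw [enorm_mul, h1, mul_one]
        generalize ‖u (ofComplex ((x : ℂ) + (y : ℂ) * Complex.I))‖ₑ = a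
        rcases le_total a 1 with h | h
        · exact h.trans le_self_add
        · refine le_trans ?_ le_add_self
          rw [sq]
          exact le_mul_of_one_le_left zero_le h
    _ = _ := by
        rw [lintegral_add_left measurable_const]
        congr 1
        simp only [lintegral_const, one_mul, Measure.restrict_apply MeasurableSet.univ, univ_inter,
          Real.volume_Ioc]
        norm_num

/-- Square-integrability controls only averages in `y`. Polynomial growth of these is enough against
an exponentially decaying solution. -/
lemma IsMaassCuspForm.exists_integral_norm_fourierCoeffAt_le {t : ℝ} {u : ℍ → ℂ}
    (hu : IsMaassCuspForm t u) (n : ℤ) :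
    ∃ B : ℝ, ∀ Y : ℝ, 1 ≤ Y →
      ∫ y in Y..(Y + 1), ‖fourierCoeffAt u n y‖ ≤ 1 + (Y + 1) ^ 2 * B := by
  set D : ℝ≥0∞ := ∫⁻ z in ModularGroup.fd, ‖u z‖ₑ ^ 2 with hD
  have hDfin : D < ⊤ := by
    have := (eLpNorm_lt_top_iff_lintegral_rpow_enorm_lt_top (by norm_num) (by norm_num)).1
      hu.square_integrable.2
    simpa using this
  refine ⟨D.toReal, fun Y hY ↦ ?_⟩
  have hum : Measurable fun z ↦ ‖u z‖ₑ ^ 2 := (hu.smooth.continuous.measurable.enorm.pow_const 2)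
  have hb : ContinuousOn (fourierCoeffAt u n) (Ioi 0) := fun y hy ↦
    (hasDerivAt_fourierCoeffAt hu.smooth n hy).continuousAt.continuousWithinAt
  have hb' : AEStronglyMeasurable (fourierCoeffAt u n) (volume.restrict (Ioc Y (Y + 1))) :=
    (hb.mono fun y hy ↦ lt_trans (by linarith) hy.1).aestronglyMeasurable measurableSet_Ioc
  rw [intervalIntegral.integral_of_le (by linarith), integral_norm_eq_lintegral_enorm hb']
  have h1 : ∫⁻ y in Ioc Y (Y + 1), ‖fourierCoeffAt u n y‖ₑ ≤
      1 + ENNReal.ofReal ((Y + 1) ^ 2) * D := by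
    calc ∫⁻ y in Ioc Y (Y + 1), ‖fourierCoeffAt u n y‖ₑ
        ≤ ∫⁻ y in Ioc Y (Y + 1), (1 + ∫⁻ x in Ioc (-(1 / 2) : ℝ) (1 / 2),
          ‖u (ofComplex ((x : ℂ) + (y : ℂ) * Complex.I))‖ₑ ^ 2) := by
          refine setLIntegral_mono' measurableSet_Ioc fun y hy ↦ ?_
          exact norm_fourierCoeffAt_le hu.isPeriodic n (by linarith [hy.1])
      _ = 1 + ∫⁻ w in cuspRect Y, ‖u (ofComplex w)‖ₑ ^ 2 := by
          rw [lintegral_add_left measurable_const, lintegral_cuspRect_eq hum]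
          congr 1
          simp
      _ ≤ _ := by
          gcongr
          exact lintegral_cuspRect_le hum hY
  have h2 : 1 + ENNReal.ofReal ((Y + 1) ^ 2) * D ≠ ⊤ :=
    ENNReal.add_ne_top.2 ⟨ENNReal.one_ne_top, ENNReal.mul_ne_top ENNReal.ofReal_ne_top hDfin.ne⟩
  refine (ENNReal.toReal_mono h2 h1).trans (le_of_eq ?_)
  rw [ENNReal.toReal_add ENNReal.one_ne_top
    (ENNReal.mul_ne_top ENNReal.ofReal_ne_top hDfin.ne), ENNReal.toReal_one, ENNReal.toReal_mul,
    ENNReal.toReal_ofReal (by positivity)]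

/-- Uniqueness for the initial value problem of `f'' = q f` on the half-line. -/
lemma eq_zero_of_second_order_ode {f f₁ : ℝ → ℂ} {q : ℝ → ℝ}
    (hf : ∀ y, 0 < y → HasDerivAt f (f₁ y) y)
    (hf₁ : ∀ y, 0 < y → HasDerivAt f₁ ((q y : ℂ) * f y) y)
    (hq : ∀ A, 0 < A → ∃ K, ∀ y, A < y → |q y| ≤ K)
    {x₀ : ℝ} (hx₀ : 0 < x₀) (h0 : f x₀ = 0) (h1 : f₁ x₀ = 0) {y : ℝ} (hy : 0 < y) : f y = 0 := by
  set A := min x₀ y / 2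
  set B := max x₀ y + 1
  have hm : 0 < min x₀ y := lt_min hx₀ hy
  have hA : 0 < A := half_pos hm
  have hAx : A < x₀ := (half_lt_self hm).trans_le (min_le_left _ _)
  have hAy : A < y := (half_lt_self hm).trans_le (min_le_right _ _)
  have hxB : x₀ < B := (le_max_left _ _).trans_lt (lt_add_one _)
  have hyB : y < B := (le_max_right _ _).trans_lt (lt_add_one _)
  obtain ⟨K, hK⟩ := hq A hA
  have hK0 : 0 ≤ K := (abs_nonneg _).trans (hK y hAy)
  -- The equation is read as a first-order system for `(f, f₁)`. The Lipschitz constant `K + 1`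
  -- dominates both `1` and `|q|`.
  have := ODE_solution_unique_of_mem_Ioo (E := ℂ × ℂ)
    (v := fun y p ↦ (p.2, (q y : ℂ) * p.1)) (s := fun _ ↦ univ) (K := ⟨K + 1, by positivity⟩)
    (f := fun y ↦ (f y, f₁ y)) (g := fun _ ↦ 0) (a := A) (b := B) (t₀ := x₀) ?_ ⟨hAx, hxB⟩
    (fun y hy ↦ ⟨(hf y (hA.trans hy.1)).prodMk (hf₁ y (hA.trans hy.1)), mem_univ _⟩)
    (fun y _ ↦ ⟨(hasDerivAt_const y (0 : ℂ × ℂ)).congr_deriv (by ext <;> simp), mem_univ _⟩)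
    (by simp [h0, h1])
  · exact congrArg Prod.fst (this ⟨hAy, hyB⟩)
  · intro y hy
    refine LipschitzOnWith.of_dist_le_mul fun p _ p' _ ↦ ?_
    rw [dist_eq_norm, dist_eq_norm]
    change ‖(p.2 - p'.2, (q y : ℂ) * p.1 - (q y : ℂ) * p'.1)‖ ≤ (K + 1) * ‖p - p'‖
    have a1 : ‖p.1 - p'.1‖ ≤ ‖p - p'‖ := norm_fst_le (p - p')
    have a2 : ‖p.2 - p'.2‖ ≤ ‖p - p'‖ := norm_snd_le (p - p')
    have a3 := norm_nonneg (p - p')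
    rw [Prod.norm_mk, ← mul_sub, norm_mul, Complex.norm_real, Real.norm_eq_abs]
    refine max_le (by nlinarith) ?_
    calc |q y| * ‖p.1 - p'.1‖ ≤ K * ‖p - p'‖ := by
          gcongr
          exact hK y hy.1
      _ ≤ _ := by nlinarith

/-- A solution of `f'' = q f` with polynomially bounded local means is a multiple of an
exponentially decaying nonzero solution. -/
lemma exists_eq_const_mul_of_decay {b b₁ β β₁ : ℝ → ℂ} {q : ℝ → ℝ}
    (hb : ∀ y, 0 < y → HasDerivAt b (b₁ y) y)
    (hb₁ : ∀ y, 0 < y → HasDerivAt b₁ ((q y : ℂ) * b y) y)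
    (hβ : ∀ y, 0 < y → HasDerivAt β (β₁ y) y)
    (hβ₁ : ∀ y, 0 < y → HasDerivAt β₁ ((q y : ℂ) * β y) y)
    (hq : ∀ A, 0 < A → ∃ K, ∀ y, A < y → |q y| ≤ K)
    {x₀ : ℝ} (hx₀ : 0 < x₀) (hne : β x₀ ≠ 0) {B : ℝ}
    (hgrow : ∀ Y : ℝ, 1 ≤ Y → ∫ y in Y..(Y + 1), ‖b y‖ ≤ 1 + (Y + 1) ^ 2 * B)
    {a C : ℝ} (ha : 0 < a) (hC : 0 ≤ C)
    (hdecay : ∀ y : ℝ, 1 ≤ y → 1 ≤ a * y → ‖β y‖ ≤ C * (y * Real.exp (-(a * y))) ∧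
      ‖β₁ y‖ ≤ C * (y * Real.exp (-(a * y)))) :
    ∃ κ : ℂ, ∀ y, 0 < y → b y = κ * β y := by
  have hwd : ∀ y, 0 < y → HasDerivAt (fun y ↦ b y * β₁ y - b₁ y * β y) 0 y := by
    intro y hy
    refine (((hb y hy).mul (hβ₁ y hy)).sub ((hb₁ y hy).mul (hβ y hy))).congr_deriv ?_
    ring
  -- The Wronskian is constant; the aim is `w = 0`.
  obtain ⟨w, hw⟩ := isOpen_Ioi.exists_is_const_of_deriv_eq_zero
    (isPreconnected_Ioi (a := (0 : ℝ)))
    (fun y hy ↦ (hwd y hy).differentiableAt.differentiableWithinAt)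
    (fun y hy ↦ (hwd y hy).deriv)
  have hbc : ∀ {Y : ℝ}, 1 ≤ Y → ContinuousOn b (uIcc Y (Y + 1)) := fun hY y hy ↦ by
    rw [uIcc_of_le (by linarith)] at hy
    exact (hb y (by linarith [hy.1])).continuousAt.continuousWithinAt
  have hkey : ∀ Y : ℝ, 1 ≤ Y → 1 ≤ a * Y →
      ‖w‖ / 6 ≤ 3 * C * ((Y + 1) * Real.exp (-(a * Y))) * (1 + (Y + 1) ^ 2 * B) := by
    intro Y hY haY
    have hpos : ∀ y ∈ uIcc Y (Y + 1), 0 < y := fun y hy ↦ by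
      rw [uIcc_of_le (by linarith)] at hy
      linarith [hy.1]
    -- The weight vanishes at both endpoints and has integral `1/6`. Integrating `(φ b β)'` then
    -- expresses `w/6` through `b`, `β` and `β₁` only. No bound on `b₁` is available, and none is
    -- needed.
    set φ : ℝ → ℝ := fun y ↦ (y - Y) * (Y + 1 - y) with hφ
    set φ' : ℝ → ℝ := fun y ↦ 2 * Y + 1 - 2 * y with hφ'
    have hφd : ∀ y, HasDerivAt φ (φ' y) y := fun y ↦ by
      refine (((hasDerivAt_id y).sub_const Y).mul ((hasDerivAt_id y).const_sub (Y + 1))).congr_deriv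
        ?_
      simp only [hφ', id]
      ring
    have hφc : Continuous φ := by fun_prop
    have hφ'c : Continuous φ' := by fun_prop
    have cb := hbc hY
    have cβ : ContinuousOn β (uIcc Y (Y + 1)) := fun y hy ↦
      (hβ y (hpos y hy)).continuousAt.continuousWithinAt
    have cβ₁ : ContinuousOn β₁ (uIcc Y (Y + 1)) := fun y hy ↦
      (hβ₁ y (hpos y hy)).continuousAt.continuousWithinAt
    have cφ : ContinuousOn (fun y ↦ (φ y : ℂ)) (uIcc Y (Y + 1)) :=
      (Complex.continuous_ofReal.comp hφc).continuousOn
    have cφ' : ContinuousOn (fun y ↦ (φ' y : ℂ)) (uIcc Y (Y + 1)) :=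
      (Complex.continuous_ofReal.comp hφ'c).continuousOn
    set I : ℝ → ℂ := fun y ↦ b y * (2 * φ y * β₁ y + φ' y * β y) with hI
    have cI : ContinuousOn I (uIcc Y (Y + 1)) :=
      cb.mul (((continuousOn_const.mul cφ).mul cβ₁).add (cφ'.mul cβ))
    have cφw : ContinuousOn (fun y ↦ (φ y : ℂ) * w) (uIcc Y (Y + 1)) := cφ.mul continuousOn_const
    have hder : ∀ y ∈ uIcc Y (Y + 1), HasDerivAt (fun y ↦ φ y * (b y * β y))
        (I y - φ y * w) y := by
      intro y hy
      have hy0 := hpos y hy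
      refine ((hφd y).ofReal_comp.mul ((hb y hy0).mul (hβ y hy0))).congr_deriv ?_
      simp only [Pi.mul_apply]
      rw [← hw y hy0, hI]
      ring
    have hftc := intervalIntegral.integral_eq_sub_of_hasDerivAt hder
      (cI.sub cφw).intervalIntegrable
    have hend : (φ (Y + 1) : ℂ) * (b (Y + 1) * β (Y + 1)) - φ Y * (b Y * β Y) = 0 := by
      simp [hφ]
    rw [hend, intervalIntegral.integral_sub cI.intervalIntegrable
      cφw.intervalIntegrable, sub_eq_zero,
      intervalIntegral.integral_mul_const, intervalIntegral.integral_ofReal] at hftc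
    have hφint : ∫ y in Y..(Y + 1), φ y = 1 / 6 := by
      have hprim : ∀ y ∈ uIcc Y (Y + 1), HasDerivAt
          (fun y ↦ (y - Y) ^ 2 / 2 - (y - Y) ^ 3 / 3) (φ y) y := fun y _ ↦ by
        have h1 := (hasDerivAt_id y).sub_const Y
        refine (((h1.pow 2).div_const 2).sub ((h1.pow 3).div_const 3)).congr_deriv ?_
        simp only [hφ, id]
        push_cast
        ring
      rw [intervalIntegral.integral_eq_sub_of_hasDerivAt hprim (hφc.intervalIntegrable _ _)]
      norm_num
    rw [hφint] at hftc
    have hnorm : ‖w‖ / 6 = ‖∫ y in Y..(Y + 1), I y‖ := by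
      rw [hftc, norm_mul, Complex.norm_real]
      norm_num
      ring
    rw [hnorm]
    set E := C * ((Y + 1) * Real.exp (-(a * Y))) with hE
    have hE0 : 0 ≤ E := by positivity
    calc ‖∫ y in Y..(Y + 1), I y‖ ≤ ∫ y in Y..(Y + 1), 3 * E * ‖b y‖ := by
          refine intervalIntegral.norm_integral_le_of_norm_le (by linarith)
            (Eventually.of_forall fun y hy ↦ ?_)
            ((continuousOn_const.mul cb.norm).intervalIntegrable)
          have hy1 : Y ≤ y := hy.1.le
          have hy2 : y ≤ Y + 1 := hy.2
          have hE' : C * (y * Real.exp (-(a * y))) ≤ E := by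
            rw [hE]; gcongr
          obtain ⟨d1, d2⟩ := hdecay y (hY.trans hy1)
            (haY.trans (mul_le_mul_of_nonneg_left hy1 ha.le))
          have d1' := d1.trans hE'
          have d2' := d2.trans hE'
          have p1 : |φ y| ≤ 1 := by
            rw [abs_le]; constructor <;> simp only [hφ] <;> nlinarith
          have p2 : |φ' y| ≤ 1 := by
            rw [abs_le]; constructor <;> simp only [hφ'] <;> linarith
          rw [hI]
          simp only
          rw [norm_mul, mul_comm (3 * E)]
          gcongr
          refine (norm_add_le _ _).trans ?_
          rw [norm_mul, norm_mul, norm_mul, Complex.norm_real, Complex.norm_real, Real.norm_eq_abs,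
            Real.norm_eq_abs, Complex.norm_ofNat]
          calc 2 * |φ y| * ‖β₁ y‖ + |φ' y| * ‖β y‖ ≤ 2 * 1 * E + 1 * E := by gcongr
            _ = 3 * E := by ring
      _ = 3 * E * ∫ y in Y..(Y + 1), ‖b y‖ := intervalIntegral.integral_const_mul _ _
      _ ≤ 3 * E * (1 + (Y + 1) ^ 2 * B) := by
          gcongr
          exact hgrow Y hY
      _ = _ := by rw [hE]; ring
  have hlim : Tendsto (fun Y : ℝ ↦ 3 * C * ((Y + 1) * Real.exp (-(a * Y))) *
      (1 + (Y + 1) ^ 2 * B)) atTop (nhds 0) := by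
    have hj : ∀ j : ℕ, Tendsto (fun Y : ℝ ↦ Y ^ j * Real.exp (-(a * Y))) atTop (nhds 0) := by
      intro j
      have := tendsto_rpow_mul_exp_neg_mul_atTop_nhds_zero j a ha
      refine this.congr fun Y ↦ ?_
      rw [Real.rpow_natCast, neg_mul]
    have := ((((hj 1).add (hj 0)).mul_const (3 * C * (1 + B))).add
      ((((hj 3).add ((hj 2).const_mul 3)).add ((hj 1).const_mul 2)).mul_const (3 * C * B)))
    simp only [add_zero, mul_zero, zero_mul] at this
    refine this.congr fun Y ↦ ?_
    ring
  have hw0 : w = 0 := by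
    have h : ‖w‖ / 6 ≤ 0 := by
      refine ge_of_tendsto hlim ?_
      filter_upwards [eventually_ge_atTop 1, eventually_ge_atTop (1 / a)] with Y h1 h2
      refine hkey Y h1 ?_
      rwa [div_le_iff₀' ha] at h2
    have := norm_nonneg w
    exact norm_eq_zero.1 (by linarith)
  refine ⟨b x₀ / β x₀, fun y hy ↦ ?_⟩
  have h := hw x₀ hx₀
  rw [hw0] at h
  -- With zero Wronskian and `β x₀ ≠ 0`, the difference has zero value and zero derivative at `x₀`.
  have := eq_zero_of_second_order_ode (f := fun y ↦ b y - b x₀ / β x₀ * β y)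
    (f₁ := fun y ↦ b₁ y - b x₀ / β x₀ * β₁ y) (q := q)
    (fun y hy ↦ (hb y hy).sub ((hβ y hy).const_mul _))
    (fun y hy ↦ ((hb₁ y hy).sub ((hβ₁ y hy).const_mul _)).congr_deriv (by ring)) hq hx₀
    (by field_simp; ring) (by field_simp; linear_combination -h) hy
  exact sub_eq_zero.1 this

lemma IsMaassCuspForm.exists_coeff {t : ℝ} {u : ℍ → ℂ} (hu : IsMaassCuspForm t u) {n : ℤ}
    (hn : n ≠ 0) : ∃ κ : ℂ, ∀ y : ℝ, 0 < y →
      fourierCoeffAt u n y = κ * besselSol t (2 * Real.pi * |(n : ℝ)|) y := by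
  set a := 2 * Real.pi * |(n : ℝ)| with ha
  have hn' : 0 < |(n : ℝ)| := abs_pos.2 (by exact_mod_cast hn)
  have ha0 : 0 < a := by positivity
  have ha2 : a ^ 2 = (2 * Real.pi * n) ^ 2 := by
    rw [ha, mul_pow, sq_abs, ← mul_pow]
  obtain ⟨B, hgrow⟩ := hu.exists_integral_norm_fourierCoeffAt_le n
  obtain ⟨C, hC, hdecay⟩ := exists_norm_besselSol_le t ha0
  obtain ⟨X, hX, hXne⟩ := exists_besselMoment_ne_zero t
  refine exists_eq_const_mul_of_decay (b₁ := fourierCoeffAt (dy u) n)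
    (q := fun y ↦ a ^ 2 - (1 / 4 + t ^ 2) / y ^ 2) (x₀ := X / a)
    (fun y hy ↦ hasDerivAt_fourierCoeffAt hu.smooth n hy) (fun y hy ↦ ?_)
    (fun y hy ↦ hasDerivAt_besselSol t ha0 hy) (fun y hy ↦ hasDerivAt_besselSolDeriv t ha0 hy)
    (fun A hA ↦ ⟨a ^ 2 + (1 / 4 + t ^ 2) / A ^ 2, fun y hy ↦ ?_⟩) (by positivity) ?_ hgrow ha0
    hC hdecay
  · refine (hasDerivAt_fourierCoeffAt hu.smooth.dy n hy).congr_deriv ?_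
    rw [hu.fourierCoeffAt_dy_dy n hy, ha2]
  · have h1 : (1 / 4 + t ^ 2) / y ^ 2 ≤ (1 / 4 + t ^ 2) / A ^ 2 := by gcongr
    have h2 : 0 ≤ (1 / 4 + t ^ 2) / y ^ 2 := by positivity
    rw [abs_le]
    constructor <;> nlinarith [sq_nonneg a]
  · rw [besselSol, mul_div_cancel₀ _ ha0.ne']
    refine mul_ne_zero ?_ hXne
    exact_mod_cast (Real.sqrt_pos.2 (by positivity)).ne'

end MaassRaised

/-! ### Uniform bounds, iterated raising and normalisation -/

namespace MaassRaised

open MeasureTheory Set Filter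

lemma exists_rpow_le_mul_two_pow {ε : ℝ} :
    ∃ D : ℝ, 0 ≤ D ∧ ∀ k : ℕ, 0 < k → (4 * k : ℝ) ^ ε ≤ D * 2 ^ k := by
  obtain ⟨N, hN⟩ := exists_nat_ge ε
  have hlog : 0 < Real.log 2 := Real.log_pos (by norm_num)
  refine ⟨4 ^ N * N.factorial / Real.log 2 ^ N, by positivity, fun k hk ↦ ?_⟩
  have hk1 : (1 : ℝ) ≤ k := by exact_mod_cast hk
  have h1 : (4 * k : ℝ) ^ ε ≤ (4 * k : ℝ) ^ N := by
    rw [← Real.rpow_natCast]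
    exact Real.rpow_le_rpow_of_exponent_le (by linarith) hN
  have h2 := Real.pow_div_factorial_le_exp (k * Real.log 2) (by positivity) N
  have h3 : Real.exp (k * Real.log 2) = 2 ^ k := by
    rw [Real.exp_nat_mul, Real.exp_log (by norm_num)]
  rw [h3, mul_pow, div_le_iff₀ (by positivity)] at h2
  refine h1.trans ?_
  rw [mul_pow, div_mul_eq_mul_div, le_div_iff₀ (by positivity)]
  have h4 := mul_le_mul_of_nonneg_left h2 (show (0 : ℝ) ≤ 4 ^ N by positivity)
  linarith

/-- For `A = 0` the logarithmic bound costs `(4k)^ε`, and this is where `2^k` is needed. For `A ≥ 1`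
integration by parts already suffices, and the factor `2^k (1+x)^ε ≥ 1` is inserted freely. -/
lemma exists_norm_oscIntegral_le (A : ℕ) {ε : ℝ} (hε : 0 < ε) :
    ∃ C : ℝ, 0 < C ∧ ∀ (k : ℕ), 0 < k → ∀ (t Y : ℝ), Y ≠ 0 →
      ‖oscIntegral t (k / 2) Y‖ ≤ C * 2 ^ k * (k : ℝ) ^ A * ((1 + |t|) / |Y|) ^ A *
        (1 + (1 + |t|) / |Y|) ^ ε := by
  have hm : ∀ k : ℕ, ((k / 2 : ℕ) : ℝ) ≤ k / 2 := fun k ↦ Nat.cast_div_le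
  rcases Nat.eq_zero_or_pos A with rfl | hA
  · obtain ⟨D, hD, hDk⟩ := exists_rpow_le_mul_two_pow (ε := ε)
    refine ⟨2 * D / ε + 1, by positivity, fun k hk t Y hY ↦ ?_⟩
    have hY' : 0 < |Y| := abs_pos.2 hY
    have hk1 : (1 : ℝ) ≤ k := by exact_mod_cast hk
    have ht := abs_nonneg t
    set x := (1 + |t|) / |Y| with hx
    have hx0 : 0 < x := by positivity
    have hT : (3 / 2 + |t| + (k / 2 : ℕ)) / |Y| ≤ 2 * k * x := by
      rw [hx, mul_div_assoc']
      gcongr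
      nlinarith [hm k]
    have h1 := norm_oscIntegral_le_arsinh t (k / 2) hY
    have h2 : Real.arsinh ((3 / 2 + |t| + (k / 2 : ℕ)) / |Y|) ≤ D * 2 ^ k * (1 + x) ^ ε / ε := by
      refine (arsinh_le_rpow (by positivity) hε).trans ?_
      gcongr
      calc (1 + 2 * ((3 / 2 + |t| + (k / 2 : ℕ)) / |Y|)) ^ ε ≤ (4 * k * (1 + x)) ^ ε := by
            gcongr
            nlinarith
        _ = (4 * k : ℝ) ^ ε * (1 + x) ^ ε := Real.mul_rpow (by positivity) (by positivity)
        _ ≤ _ := by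
            gcongr
            exact hDk k hk
    have h3 : (1 : ℝ) ≤ 2 ^ k * (1 + x) ^ ε :=
      one_le_mul_of_one_le_of_one_le (one_le_pow₀ (by norm_num))
        (Real.one_le_rpow (by linarith) hε.le)
    rw [pow_zero, pow_zero, mul_one, mul_one]
    calc _ ≤ _ := h1
      _ ≤ 2 * (D * 2 ^ k * (1 + x) ^ ε / ε) + 2 ^ k * (1 + x) ^ ε := by gcongr
      _ = _ := by ring
  · refine ⟨Real.pi * (1 + A) ^ A, by positivity, fun k hk t Y hY ↦ ?_⟩
    have hY' : 0 < |Y| := abs_pos.2 hY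
    have hk1 : (1 : ℝ) ≤ k := by exact_mod_cast hk
    have ht := abs_nonneg t
    have hA0 : (0 : ℝ) ≤ A := A.cast_nonneg
    set x := (1 + |t|) / |Y| with hx
    have hx0 : 0 < x := by positivity
    have hT : (1 / 2 + |t| + (k / 2 : ℕ) + A) / |Y| ≤ (1 + A) * k * x := by
      rw [hx, mul_div_assoc']
      gcongr
      have h1 : 1 / 2 + |t| + (k / 2 : ℕ) ≤ k * (1 + |t|) := by nlinarith [hm k]
      have h2 : 1 ≤ k * (1 + |t|) := by nlinarith
      nlinarith
    have h3 : (1 : ℝ) ≤ 2 ^ k * (1 + x) ^ ε :=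
      one_le_mul_of_one_le_of_one_le (one_le_pow₀ (by norm_num))
        (Real.one_le_rpow (by linarith) hε.le)
    calc ‖oscIntegral t (k / 2) Y‖
        ≤ Real.pi * ((1 / 2 + |t| + (k / 2 : ℕ) + A) / |Y|) ^ A := norm_oscIntegral_le t _ hA hY
      _ ≤ Real.pi * ((1 + A) * k * x) ^ A := by gcongr
      _ ≤ Real.pi * ((1 + A) * k * x) ^ A * (2 ^ k * (1 + x) ^ ε) :=
          le_mul_of_one_le_right (by positivity) h3
      _ = _ := by rw [mul_pow, mul_pow]; ring

/-- The power `y^{1-s}` for `s = 1/2 + it`. -/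
noncomputable def dualPower (t y : ℝ) : ℂ := Complex.exp ((1 - critPoint t) * (Real.log y : ℝ))

lemma norm_dualPower (t : ℝ) {y : ℝ} (hy : 0 < y) : ‖dualPower t y‖ = Real.sqrt y := by
  rw [dualPower, Complex.norm_exp, ← Real.exp_log (Real.sqrt_pos.2 hy), Real.log_sqrt hy.le]
  congr 1
  simp [critPoint]
  ring

lemma hasDerivAt_dualPower (t : ℝ) {y : ℝ} (hy : 0 < y) :
    HasDerivAt (dualPower t) ((1 - critPoint t) * dualPower t y / y) y := by
  refine ((Real.hasDerivAt_log hy.ne').ofReal_comp.const_mul (1 - critPoint t)).cexp.congr_deriv ?_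
  rw [dualPower]
  push_cast
  ring

lemma dualPower_mul_cpow (t : ℝ) {y : ℝ} (hy : 0 < y) :
    dualPower t y * (y : ℂ) ^ (Complex.I * t) = (Real.sqrt y : ℂ) := by
  rw [Complex.cpow_def_of_ne_zero (by exact_mod_cast hy.ne'), ← Complex.ofReal_log hy.le,
    dualPower, ← Complex.exp_add, ← Real.exp_log (Real.sqrt_pos.2 hy), Real.log_sqrt hy.le,
    Complex.ofReal_exp]
  congr 1
  rw [critPoint]
  push_cast
  ring

/-- The constant relating `√y K_{it}(2π|n|y)` to `y^{1-s}` times the oscillatory integral. -/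
noncomputable def unfoldConst (t : ℝ) (n : ℤ) : ℂ :=
  Complex.Gamma (critPoint t) /
    (((Real.sqrt Real.pi : ℝ) : ℂ) * ((Real.pi * |(n : ℝ)| : ℝ) : ℂ) ^ (Complex.I * t))

lemma norm_unfoldConst_le (t : ℝ) {n : ℤ} (hn : n ≠ 0) : ‖unfoldConst t n‖ ≤ 1 := by
  have hn' : 0 < |(n : ℝ)| := abs_pos.2 (by exact_mod_cast hn)
  have hs : 0 < Real.sqrt Real.pi := Real.sqrt_pos.2 Real.pi_pos
  rw [unfoldConst, norm_div, norm_mul, Complex.norm_real, Real.norm_of_nonneg hs.le,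
    Complex.norm_cpow_eq_rpow_re_of_pos (by positivity)]
  simp only [Complex.mul_re, Complex.I_re, Complex.I_im, Complex.ofReal_re, Complex.ofReal_im,
    zero_mul, mul_zero, sub_zero, Real.rpow_zero, mul_one]
  exact div_le_one_of_le₀ (norm_Gamma_critPoint_le t) hs.le

lemma two_mul_besselSol_eq (t : ℝ) {n : ℤ} (hn : n ≠ 0) {y : ℝ} (hy : 0 < y) :
    2 * besselSol t (2 * Real.pi * |(n : ℝ)|) y =
      unfoldConst t n * (dualPower t y * oscIntegral t 0 (n * y)) := by
  have hn' : 0 < |(n : ℝ)| := abs_pos.2 (by exact_mod_cast hn)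
  have hnr : (n : ℝ) ≠ 0 := by exact_mod_cast hn
  have h := Gamma_mul_oscIntegral_zero t (mul_ne_zero hnr hy.ne')
  rw [abs_mul, abs_of_pos hy, ← mul_assoc, ← mul_assoc,
    Complex.ofReal_mul (Real.pi * |(n : ℝ)|),
    Complex.mul_cpow_ofReal_nonneg (by positivity) hy.le] at h
  have hs : ((Real.sqrt Real.pi : ℝ) : ℂ) ≠ 0 := by
    exact_mod_cast (Real.sqrt_pos.2 Real.pi_pos).ne'
  have hp : ((Real.pi * |(n : ℝ)| : ℝ) : ℂ) ^ (Complex.I * t) ≠ 0 := by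
    rw [Complex.cpow_ne_zero_iff]
    left
    exact_mod_cast (show 0 < Real.pi * |(n : ℝ)| by positivity).ne'
  rw [unfoldConst, besselSol, ← dualPower_mul_cpow t hy]
  generalize oscIntegral t 0 (n * y) = J at h ⊢
  field_simp
  linear_combination (-dualPower t y) * h

/-- The term `1 - s` from differentiating `y^{1-s}` cancels against the one in
`hasDerivAt_oscIntegral`, as do `m` and `2πny`. Each raising thus leaves just the factor `s + m` and
the next integral. -/
lemma fourierCoeffAt_iterRaising_eq {u : ℍ → ℂ} (hs : IsSmooth u) (hp : IsPeriodic u) {t : ℝ}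
    {n : ℤ} (hn : n ≠ 0) {κ : ℂ}
    (h0 : ∀ y : ℝ, 0 < y →
      fourierCoeffAt u n y = κ * (dualPower t y * oscIntegral t 0 (n * y))) (m : ℕ) :
    ∀ y : ℝ, 0 < y → fourierCoeffAt (iterRaising u m) n y =
      κ * (∏ l ∈ Finset.range m, (critPoint t + l)) *
        (dualPower t y * oscIntegral t m (n * y)) := by
  have hnr : (n : ℝ) ≠ 0 := by exact_mod_cast hn
  induction m with
  | zero => intro y hy; simpa [iterRaising] using h0 y hy
  | succ m ih =>
    intro y hy
    have hyc : (y : ℂ) ≠ 0 := by exact_mod_cast hy.ne'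
    have hnc : (n : ℂ) ≠ 0 := by exact_mod_cast hn
    have hlin : HasDerivAt (fun y : ℝ ↦ n * y) (n : ℝ) y := by
      simpa using (hasDerivAt_id y).const_mul (n : ℝ)
    have hd := ((hasDerivAt_dualPower t hy).mul
      ((hasDerivAt_oscIntegral t m (mul_ne_zero hnr hy.ne')).scomp y hlin)).const_mul
      (κ * ∏ l ∈ Finset.range m, (critPoint t + l))
    have hloc : fourierCoeffAt (iterRaising u m) n =ᶠ[nhds y] fun y ↦
        κ * (∏ l ∈ Finset.range m, (critPoint t + l)) *
        (dualPower t y * oscIntegral t m (n * y)) := by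
      filter_upwards [lt_mem_nhds hy] with y' hy' using ih y' hy'
    have hd' := (hd.congr_of_eventuallyEq hloc).deriv
    rw [fourierCoeffAt_iterRaising_succ hs hp m n hy, hd', ih y hy, Finset.prod_range_succ]
    simp only [Function.comp_apply, Complex.real_smul]
    push_cast
    field_simp
    ring

/-- Both sides square to `(l + 1/2)² + t²`. This identity makes the normalisation cancel the raising
factors. -/
lemma norm_critPoint_add (t : ℝ) (l : ℕ) :
    ‖critPoint t + l‖ = Real.sqrt (1 / 4 + t ^ 2 - lam (-(l : ℝ))) := by
  rw [Complex.norm_eq_sqrt_sq_add_sq]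
  congr 1
  simp [critPoint, lam]
  ring

lemma norm_fourierCoeffAt_raisedForm_le {u : ℍ → ℂ} (hs : IsSmooth u) (hp : IsPeriodic u) {t : ℝ}
    {n : ℤ} (hn : n ≠ 0) {c : ℂ}
    (h0 : ∀ y : ℝ, 0 < y →
      fourierCoeffAt u n y = c * (2 * besselSol t (2 * Real.pi * |(n : ℝ)|) y))
    (k : ℕ) {y : ℝ} (hy : 0 < y) :
    ‖fourierCoeffAt (raisedForm t u k) n y‖ ≤
      ‖c‖ * Real.sqrt y * ‖oscIntegral t (k / 2) (n * y)‖ := by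
  have h1 := fourierCoeffAt_iterRaising_eq hs hp hn (t := t) (κ := c * unfoldConst t n)
    (fun y hy ↦ by rw [h0 y hy, two_mul_besselSol_eq t hn hy, mul_assoc]) (k / 2) y hy
  have hpos : ∀ l : ℕ, 0 < Real.sqrt (1 / 4 + t ^ 2 - lam (-(l : ℝ))) := fun l ↦ by
    refine Real.sqrt_pos.2 ?_
    have : (0 : ℝ) ≤ l := l.cast_nonneg
    rw [lam]
    nlinarith [sq_nonneg t]
  set P := ∏ l ∈ Finset.range (k / 2), Real.sqrt (1 / 4 + t ^ 2 - lam (-(l : ℝ))) with hP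
  have hP0 : 0 < P := Finset.prod_pos fun l _ ↦ hpos l
  have e1 : ‖∏ l ∈ Finset.range (k / 2), (critPoint t + l)‖ = P := by
    rw [norm_prod, hP]
    exact Finset.prod_congr rfl fun l _ ↦ norm_critPoint_add t l
  have e2 : (∏ l ∈ Finset.range (k / 2),
      (Real.sqrt (1 / 4 + t ^ 2 - lam (-(l : ℝ))))⁻¹) = P⁻¹ := by
    rw [hP, Finset.prod_inv_distrib]
  have e3 : fourierCoeffAt (raisedForm t u k) n y =
      ((P⁻¹ : ℝ) : ℂ) * fourierCoeffAt (iterRaising u (k / 2)) n y := by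
    rw [← e2, ← fourierCoeffAt_const_mul]
    rfl
  rw [e3, h1, norm_mul, norm_mul, norm_mul, norm_mul, norm_mul, e1, norm_dualPower t hy,
    Complex.norm_real, Real.norm_of_nonneg (by positivity)]
  calc P⁻¹ * (‖c‖ * ‖unfoldConst t n‖ * P * (Real.sqrt y * ‖oscIntegral t (k / 2) (n * y)‖))
      = ‖unfoldConst t n‖ * (‖c‖ * Real.sqrt y * ‖oscIntegral t (k / 2) (n * y)‖) := by
        field_simp
    _ ≤ 1 * (‖c‖ * Real.sqrt y * ‖oscIntegral t (k / 2) (n * y)‖) := by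
        gcongr
        exact norm_unfoldConst_le t hn
    _ = _ := one_mul _

lemma whittakerZero_eq (t : ℝ) {n : ℤ} (hn : n ≠ 0) {y : ℝ} (hy : 0 < y) :
    (1 : ℂ) / (Real.sqrt |(n : ℝ)| : ℂ) *
        whittakerZero (Complex.I * (t : ℂ)) (4 * Real.pi * |(n : ℝ)| * y) =
      2 * besselSol t (2 * Real.pi * |(n : ℝ)|) y := by
  have hn' : 0 < |(n : ℝ)| := abs_pos.2 (by exact_mod_cast hn)
  have hs : ((Real.sqrt |(n : ℝ)| : ℝ) : ℂ) ≠ 0 := by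
    exact_mod_cast (Real.sqrt_pos.2 hn').ne'
  have e1 : 4 * Real.pi * |(n : ℝ)| * y / Real.pi = 2 ^ 2 * |(n : ℝ)| * y := by
    have := Real.pi_ne_zero
    field_simp
    norm_num
  have e2 : 4 * Real.pi * |(n : ℝ)| * y / 2 = 2 * Real.pi * |(n : ℝ)| * y := by ring
  rw [whittakerZero, e1, e2, besselK_eq_besselMoment, besselSol, Real.sqrt_mul (by positivity),
    Real.sqrt_mul (by positivity), Real.sqrt_sq (by norm_num)]
  push_cast
  field_simp

/-- For an even or odd form there are Fourier coefficients of modulus invariant under `n ↦ -n`. -/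
lemma IsMaassCuspForm.exists_symmetric_coeff {t : ℝ} {u : ℍ → ℂ} (hu : IsMaassCuspForm t u)
    (hpar : IsEvenForm u ∨ IsOddForm u) :
    ∃ c : ℤ → ℂ, (∀ n, n ≠ 0 → ‖c n‖ = ‖c |n|‖) ∧ ∀ n : ℤ, n ≠ 0 → ∀ y : ℝ, 0 < y →
      fourierCoeffAt u n y = c n * (2 * besselSol t (2 * Real.pi * |(n : ℝ)|) y) := by
  obtain ⟨σ, hσ1, hσ⟩ : ∃ σ : ℂ, ‖σ‖ = 1 ∧
      ∀ z : ℍ, u (ofComplex (-(starRingEnd ℂ) (z : ℂ))) = σ * u z := by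
    rcases hpar with h | h
    · exact ⟨1, norm_one, fun z ↦ by rw [h z, one_mul]⟩
    · exact ⟨-1, by rw [norm_neg, norm_one], fun z ↦ by rw [h z, neg_one_mul]⟩
  choose! κ hκ using fun (n : ℤ) (hn : n ≠ 0) ↦ hu.exists_coeff hn
  -- Only the constants at positive indices are used, so the symmetry of `|c|` holds by
  -- construction. The half offsets the factor `2` in `whittakerZero_eq`.
  refine ⟨fun n ↦ (if 0 < n then 1 else σ) * (κ |n| / 2), fun n hn ↦ ?_, fun n hn y hy ↦ ?_⟩
  · simp only [abs_abs, abs_pos.2 hn, if_true, norm_mul, norm_one]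
    split_ifs <;> simp [hσ1]
  · rcases lt_or_gt_of_ne hn with h | h
    · have h1 := fourierCoeffAt_neg_of_reflect hu.isPeriodic hσ (-n) hy
      rw [neg_neg, hκ (-n) (neg_ne_zero.2 hn) y hy] at h1
      simp only [not_lt.2 h.le, if_false, abs_of_neg h]
      rw [h1, Int.cast_neg, abs_neg]
      ring
    · simp only [h, if_true, abs_of_pos h]
      rw [hκ n hn y hy]
      ring

end MaassRaised

theorem mainTheorem9 (A : ℕ) (ε : ℝ) (hε : 0 < ε) :
    ∃ C : ℝ, 0 < C ∧
      ∀ (k : ℕ), Even k → 0 < k →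
      ∀ (t : ℝ) (u : UpperHalfPlane → ℂ), MaassRaised.IsMaassCuspForm t u →
        (MaassRaised.IsEvenForm u ∨ MaassRaised.IsOddForm u) →
        ∃ c : ℤ → ℂ, MaassRaised.IsFourierWhittaker t u c ∧
          (∀ y : ℝ, 0 < y →
            MaassRaised.fourierCoeffAt (MaassRaised.raisedForm t u k) 0 y = 0) ∧
          (∀ n : ℤ, n ≠ 0 → ∀ y : ℝ, 0 < y →
            ‖MaassRaised.fourierCoeffAt (MaassRaised.raisedForm t u k) n y +
                MaassRaised.fourierCoeffAt (MaassRaised.raisedForm t u k) (-n) y‖ ≤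
              C * 2 ^ k * (k : ℝ) ^ A * Real.sqrt y * ‖c |n|‖ *
                ((1 + |t|) / (|(n : ℝ)| * y)) ^ A *
                (1 + (1 + |t|) / (|(n : ℝ)| * y)) ^ ε) := by
  obtain ⟨C, hC, hosc⟩ := MaassRaised.exists_norm_oscIntegral_le A hε
  refine ⟨2 * C, by positivity, fun k _ hk t u hu hpar ↦ ?_⟩
  obtain ⟨c, hcabs, hc⟩ := hu.exists_symmetric_coeff hpar
  refine ⟨c, fun n hn y hy ↦ ?_, fun y hy ↦ ?_, fun n hn y hy ↦ ?_⟩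
  · rw [hc n hn y hy, ← MaassRaised.whittakerZero_eq t hn hy]
    ring
  · have h := MaassRaised.fourierCoeffAt_zero_iterRaising hu.smooth hu.isPeriodic hu.cuspidal
      (k / 2) y hy
    have h' := MaassRaised.fourierCoeffAt_const_mul (MaassRaised.iterRaising u (k / 2))
      ((∏ l ∈ Finset.range (k / 2),
        (Real.sqrt (1 / 4 + t ^ 2 - MaassRaised.lam (-(l : ℝ))))⁻¹ : ℝ) : ℂ) 0 y
    rw [h, mul_zero] at h'
    exact h'
  -- One bound covers `l = n` and `l = -n`, since it depends on `l` only through `|l|`; adding the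
  -- two doubles the constant.
  · have hbound : ∀ l : ℤ, l ≠ 0 → |l| = |n| →
        ‖MaassRaised.fourierCoeffAt (MaassRaised.raisedForm t u k) l y‖ ≤
          C * 2 ^ k * (k : ℝ) ^ A * Real.sqrt y * ‖c |n|‖ *
            ((1 + |t|) / (|(n : ℝ)| * y)) ^ A * (1 + (1 + |t|) / (|(n : ℝ)| * y)) ^ ε := by
      intro l hl hln
      have hl' : (l : ℝ) ≠ 0 := by exact_mod_cast hl
      have habs : |(l : ℝ)| = |(n : ℝ)| := by
        rw [← Int.cast_abs, hln, Int.cast_abs]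
      have h1 := MaassRaised.norm_fourierCoeffAt_raisedForm_le hu.smooth hu.isPeriodic hl
        (hc l hl) k hy
      have h2 := hosc k hk t (l * y) (mul_ne_zero hl' hy.ne')
      rw [abs_mul, abs_of_pos hy, habs] at h2
      rw [hcabs l hl, hln] at h1
      refine h1.trans ((mul_le_mul_of_nonneg_left h2 (by positivity)).trans (le_of_eq ?_))
      ring
    calc _ ≤ _ := norm_add_le _ _
      _ ≤ _ := add_le_add (hbound n hn rfl) (hbound (-n) (neg_ne_zero.2 hn) (abs_neg n))
      _ = _ := by ring
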